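/- Let $-\infty<a<b\le\infty$, let $p,q$ be complex-valued and $w$ real-valued on $[a,b)$ with $w>0$ and $p\ne0$ a.e., $w,1/p,q\in L^1_{loc}[a,b)$, and suppose that $Q=\overline{\mathrm{co}}\{q(x)/w(x)+rp(x):x\in[a,b),\,0<r<\infty\}\neq\mathbb C$, and that $b$ is singular, i.e. $b=\infty$ or $\int_a^b(w+1/|p|+|q|)\,dx=\infty$. Put $\mathcal M[y]=w^{-1}(-(py')'+qy)$ and $[u,v]=p(uv'-u'v)$. Call $(\eta,K)\in\mathbb R\times\mathbb C$ admissible if there is $\lambda_0\in\mathbb C\setminus Q$ with nearest point $K$ in $Q$ such that $\Re[(rp(x)+q(x)/w(x)-K)e^{i\eta}]\ge0$ for all $x\in[a,b)$, $r>0$, and $\Re[(\lambda_0-K)e^{i\eta}]<0$; put $\Lambda_{\eta,K}=\{\lambda:\Re[(\lambda-K)e^{i\eta}]\le0\}$. Let $\alpha\in\mathbb C$ and let $(\eta,K)$ be admissible with $\Re[e^{i\eta}\cos\alpha\,\overline{\sin\alpha}]\le0$. Suppose that $\mathcal M$ is in Sims Case II or III at $b$ with respect to $(\eta,K)$: for some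 $\lambda\in\Lambda_{\eta,K}$ all solutions of $\mathcal M[y]=\lambda y$ lie in $L^2_w[a,b)$, and either (Case II) up to constant multiples exactly one nontrivial solution, or (Case III) every solution, satisfies $$\int_a^b\Re[e^{i\eta}\{p|y'|^2+(q-Kw)|y|^2\}]\,dx+\int_a^b|y|^2w\,dx<\infty .$$ For $\lambda\in\mathbb C$ let $\theta(\cdot,\lambda),\phi(\cdot,\lambda)$ be the solutions of $\mathcal M[y]=\lambda y$ with $\phi(a,\lambda)=\sin\alpha$, $p\phi'(a,\lambda)=-\cos\alpha$, $\theta(a,\lambda)=\cos\alpha$, $p\theta'(a,\lambda)=\sin\alpha$. Fix $\lambda'\in\Lambda_{\eta,K}$ and $m(\lambda')\in\mathbb C$, and let $\psi=\theta(\cdot,\lambda')+m(\lambda')\phi(\cdot,\lambda')$. Let $M$ be the operator $My=\mathcal M[y]$ in $L^2_w[a,b)$ whose domain consists of all $y\in L^2_w[a,b)$ with $y,py'$ locally absolutely continuous on $[a,b)$, $\mathcal M[y]\in L^2_w[a,b)$, $y(a)\cos\alpha+py'(a)\sin\alpha=0$ and $[y,\psi](b)=\lim_{x\to b}[y,\psi](x)=0$.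 Let $a<b_n<b$, $b_n\nearrow b$, and let $M_n$ be the operator $M_ny=\mathcal M[y]$ in $L^2_w[a,b_n]$ whose domain consists of all $y\in L^2_w[a,b_n]$ with $y,py'$ absolutely continuous on $[a,b_n]$, $\mathcal M[y]\in L^2_w[a,b_n]$, $y(a)\cos\alpha+py'(a)\sin\alpha=0$ and $[y,\psi](b_n)=0$. Let $$m_n(\lambda)=-\frac{[\theta(\cdot,\lambda),\psi](b_n)}{[\phi(\cdot,\lambda),\psi](b_n)},\qquad \psi_n(x,\lambda)=\theta(x,\lambda)+m_n(\lambda)\phi(x,\lambda),$$ so that $[\psi_n(\cdot,\lambda),\psi](b_n)=0$, and let $$G_n(x,y,\lambda)=\begin{cases}\phi(x,\lambda)\psi_n(y,\lambda),&a<x<y<b,\\ \psi_n(x,\lambda)\phi(y,\lambda),&a<y<x<b.\end{cases}$$ Let $z\in\mathbb C$ be such that $z\notin\sigma(M)$ and $z\notin\sigma(M_n)$ for all sufficiently large $n$, and let $R(z)=(zI-M)^{-1}$. Then for all sufficiently large $n$ the formula $$(R_n(z)f)(x)=\int_a^{b_n}G_n(x,y,z)f(y)w(y)\,dy,\qquad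 f\in L^2_w[a,b),\ x\in[a,b),$$ defines a bounded operator on $L^2_w[a,b)$ which extends $(zI-M_n)^{-1}$, in the sense that $(R_n(z)f)|_{[a,b_n]}=(zI-M_n)^{-1}(f|_{[a,b_n]})$, and $\|R_n(z)-R(z)\|\to0$ in operator norm as $n\to\infty$. -/

import Mathlib

open MeasureTheory Filter Topology

noncomputable section

/-- The points of `[a, b)`, where `-∞ < a < b ≤ ∞`. -/
def leftClosedInterval (a : ℝ) (b : EReal) : Set ℝ :=
  {x : ℝ | a ≤ x ∧ (x : EReal) < b}

/-- The closed convex hull of `{q(x)/w(x) + r p(x) : x ∈ [a,b), 0 < r < ∞}`. -/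
def coefficientHull (a : ℝ) (b : EReal) (p q : ℝ → ℂ) (w : ℝ → ℝ) : Set ℂ :=
  closure (convexHull ℝ
    {ζ : ℂ | ∃ x ∈ leftClosedInterval a b, ∃ r : ℝ, 0 < r ∧ ζ = q x / (w x : ℂ) + (r : ℂ) * p x})

/-- A differential expression `M[y] = w⁻¹ (-(p y')' + q y)` on `[a, b)` with complex-valued `p, q`,
regular at `a`, singular at `b`, for which the closed convex hull above is not all of `ℂ`. -/
structure SLExpr where
  a : ℝ
  b : EReal
  p : ℝ → ℂ
  q : ℝ → ℂ
  w : ℝ → ℝ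
  a_lt_b : (a : EReal) < b
  w_pos : ∀ᵐ x, x ∈ leftClosedInterval a b → 0 < w x
  p_ne_zero : ∀ᵐ x, x ∈ leftClosedInterval a b → p x ≠ 0
  w_loc : LocallyIntegrableOn w (leftClosedInterval a b)
  inv_p_loc : LocallyIntegrableOn (fun x => (p x)⁻¹) (leftClosedInterval a b)
  q_loc : LocallyIntegrableOn q (leftClosedInterval a b)
  hull_ne_univ : coefficientHull a b p q w ≠ Set.univ
  singular : b = ⊤ ∨
    ¬ IntegrableOn (fun x => w x + 1 / ‖p x‖ + ‖q x‖) (leftClosedInterval a b)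

namespace SLExpr

/-- The interval `[a, b)`. -/
def I (E : SLExpr) : Set ℝ := leftClosedInterval E.a E.b

/-- The set `Q`. -/
def Q (E : SLExpr) : Set ℂ := coefficientHull E.a E.b E.p E.q E.w

/-- The filter of real `x` tending to `b` from the left (`atTop` if `b = ∞`). -/
def atEnd (E : SLExpr) : Filter ℝ := comap (fun x : ℝ => (x : EReal)) (𝓝[<] E.b)

/-- The measure `w dx` on `s`. -/
def wMeasure (E : SLExpr) (s : Set ℝ) : Measure ℝ :=
  (volume.restrict s).withDensity (fun x => ENNReal.ofReal (E.w x))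

/-- The weighted space `L²_w(s)`. -/
abbrev L2w (E : SLExpr) (s : Set ℝ) : Type := Lp ℂ 2 (E.wMeasure s)

/-- On the interval `s` with left endpoint `a`, `y` and `u = p y'` are locally absolutely
continuous and `-(p y')' + q y = w g` almost everywhere. Absolute continuity together with the
values of the derivatives is written in integrated form (all the integrands are integrable on
compact subintervals when `y`, `u` are continuous and `g` is continuous or lies in `L²_w(s)`). -/
def Solves (E : SLExpr) (s : Set ℝ) (g y u : ℝ → ℂ) : Prop :=
  ContinuousOn y s ∧ ContinuousOn u s ∧
    ∀ x ∈ s, y x = y E.a + ∫ t in E.a..x, u t / E.p t ∧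
      u x = u E.a + ∫ t in E.a..x, (E.q t * y t - (E.w t : ℂ) * g t)

/-- `y`, with quasi-derivative `u = p y'`, solves `M[y] = l y` on `[a, b)`. -/
def IsSolution (E : SLExpr) (l : ℂ) (y u : ℝ → ℂ) : Prop :=
  E.Solves E.I (fun x => l * y x) y u

/-- `(η, K)` is admissible: for some `l₀ ∉ Q` with nearest point `K` in `Q`, the line through `K`
with direction determined by `η` separates `l₀` from `Q`. -/
def IsAdmissible (E : SLExpr) (η : ℝ) (K : ℂ) : Prop :=
  ∃ l₀ : ℂ, l₀ ∉ E.Q ∧ K ∈ E.Q ∧ (∀ ζ ∈ E.Q, ‖l₀ - K‖ ≤ ‖l₀ - ζ‖) ∧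
    (∀ x ∈ E.I, ∀ r : ℝ, 0 < r →
      0 ≤ (((r : ℂ) * E.p x + E.q x / (E.w x : ℂ) - K) * Complex.exp (Complex.I * η)).re) ∧
    ((l₀ - K) * Complex.exp (Complex.I * η)).re < 0

/-- The set `S(α)` of admissible pairs compatible with the boundary condition at `a`. -/
def S (E : SLExpr) (α : ℂ) : Set (ℝ × ℂ) :=
  {ηK | E.IsAdmissible ηK.1 ηK.2 ∧
    (Complex.exp (Complex.I * ηK.1) * Complex.cos α * starRingEnd ℂ (Complex.sin α)).re ≤ 0}

/-- The half plane `Λ_{η,K}`. -/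
def halfPlane (η : ℝ) (K : ℂ) : Set ℂ :=
  {l : ℂ | ((l - K) * Complex.exp (Complex.I * η)).re ≤ 0}

/-- `y ∈ L²_w[a,b)` for a continuous function `y`. -/
def SqIntegrable (E : SLExpr) (y : ℝ → ℂ) : Prop :=
  IntegrableOn (fun x => ‖y x‖ ^ 2 * E.w x) E.I

/-- `∫ Re[e^{iη} (p |y'|² + (q - K w) |y|²)] dx + ∫ |y|² w dx < ∞`, where `y' = u / p`. -/
def FiniteForm (E : SLExpr) (η : ℝ) (K : ℂ) (y u : ℝ → ℂ) : Prop :=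
  IntegrableOn (fun x => (Complex.exp (Complex.I * η) *
      (E.p x * ((‖u x / E.p x‖ ^ 2 : ℝ) : ℂ) +
        (E.q x - K * (E.w x : ℂ)) * ((‖y x‖ ^ 2 : ℝ) : ℂ))).re) E.I ∧
    E.SqIntegrable y

/-- Sims Case II for `(η, K)`: up to constant multiples exactly one nontrivial solution satisfies
the finiteness condition, while all solutions lie in `L²_w[a,b)`. The classification does not depend
on `l ∈ Λ_{η,K}`; here only one such `l` is asked for. -/
def CaseII (E : SLExpr) (η : ℝ) (K : ℂ) : Prop :=
  ∃ l ∈ halfPlane η K,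
    (∃ y u : ℝ → ℂ, E.IsSolution l y u ∧ (∃ x ∈ E.I, y x ≠ 0) ∧ E.FiniteForm η K y u ∧
      ∀ y' u' : ℝ → ℂ, E.IsSolution l y' u' → E.FiniteForm η K y' u' →
        ∃ c : ℂ, ∀ x ∈ E.I, y' x = c * y x) ∧
    ∀ y u : ℝ → ℂ, E.IsSolution l y u → E.SqIntegrable y

/-- Sims Case III for `(η, K)`: all solutions lie in `L²_w[a,b)` and satisfy the finiteness
condition (for one, equivalently every, `l ∈ Λ_{η,K}`). -/
def CaseIII (E : SLExpr) (η : ℝ) (K : ℂ) : Prop :=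
  ∃ l ∈ halfPlane η K, ∀ y u : ℝ → ℂ, E.IsSolution l y u →
    E.SqIntegrable y ∧ E.FiniteForm η K y u

/-- `θ(·, l)` and `φ(·, l)`, with quasi-derivatives `θ₁ = p θ'` and `φ₁ = p φ'`, are the solutions
of `M[y] = l y` with `φ = sin α`, `p φ' = -cos α`, `θ = cos α`, `p θ' = sin α` at `a`. -/
def IsFundamentalPair (E : SLExpr) (α : ℂ) (θ θ₁ φ φ₁ : ℂ → ℝ → ℂ) : Prop :=
  ∀ l : ℂ, E.IsSolution l (θ l) (θ₁ l) ∧ E.IsSolution l (φ l) (φ₁ l) ∧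
    φ l E.a = Complex.sin α ∧ φ₁ l E.a = -Complex.cos α ∧
    θ l E.a = Complex.cos α ∧ θ₁ l E.a = Complex.sin α

/-- The Wronskian `[y, v] = p (y v' - y' v)`, with `u = p y'` and `v₁ = p v'`. -/
def wronskian (y u v v₁ : ℝ → ℂ) (x : ℝ) : ℂ := y x * v₁ x - u x * v x

/-- The boundary condition `y cos α + p y' sin α = 0` at `a`. -/
def BCa (E : SLExpr) (α : ℂ) (y u : ℝ → ℂ) : Prop :=
  y E.a * Complex.cos α + u E.a * Complex.sin α = 0

/-- The graph of the operator `M` in `L²_w[a,b)`: `M f = M[f]` for those `f` such that `f`, `p f'` are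
locally absolutely continuous, `f, M[f] ∈ L²_w[a,b)`, the boundary condition holds at `a`, and
`[f, ψ](b) = 0`; here `ψ₁ = p ψ'`. -/
def graphM (E : SLExpr) (α : ℂ) (ψ ψ₁ : ℝ → ℂ) : Set (E.L2w E.I × E.L2w E.I) :=
  {fg | ∃ y u : ℝ → ℂ, fg.1 =ᵐ[E.wMeasure E.I] y ∧ E.Solves E.I fg.2 y u ∧ E.BCa α y u ∧
    Tendsto (wronskian y u ψ ψ₁) E.atEnd (𝓝 0)}

/-- The graph of the regular operator in `L²_w[a,c]` with the same boundary condition at `a` and the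
boundary condition `[f, ψ](c) = 0`. -/
def graphTrunc (E : SLExpr) (α : ℂ) (ψ ψ₁ : ℝ → ℂ) (c : ℝ) :
    Set (E.L2w (Set.Icc E.a c) × E.L2w (Set.Icc E.a c)) :=
  {fg | ∃ y u : ℝ → ℂ, fg.1 =ᵐ[E.wMeasure (Set.Icc E.a c)] y ∧
    E.Solves (Set.Icc E.a c) fg.2 y u ∧ E.BCa α y u ∧ wronskian y u ψ ψ₁ c = 0}

/-- The Titchmarsh-Weyl function of the problem on `[a,c]`: the number `m` for which `θ + m φ`
satisfies `[θ + m φ, ψ](c) = 0`. -/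
def mTrunc (θ θ₁ φ φ₁ ψ ψ₁ : ℝ → ℂ) (c : ℝ) : ℂ :=
  -(wronskian θ θ₁ ψ ψ₁ c) / wronskian φ φ₁ ψ ψ₁ c

/-- The kernel `φ(x) ψ(t)` for `x < t` and `ψ(x) φ(t)` for `t < x`. -/
def green (φ ψ : ℝ → ℂ) (x t : ℝ) : ℂ := if x < t then φ x * ψ t else ψ x * φ t

end SLExpr

/-- `R` is the bounded, everywhere defined inverse `(z - T)⁻¹` of `z - T`, for the operator `T` with
graph `G`: `R h = f` holds exactly if `f` is in the domain of `T` and `z f - T f = h`. -/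
def IsResolventAt {H : Type*} [NormedAddCommGroup H] [NormedSpace ℂ H] (G : Set (H × H)) (z : ℂ)
    (R : H →L[ℂ] H) : Prop :=
  ∀ f h : H, R h = f ↔ (f, z • f - h) ∈ G

/-- The spectrum of the operator with graph `G`. -/
def graphSpectrum {H : Type*} [NormedAddCommGroup H] [NormedSpace ℂ H] (G : Set (H × H)) : Set ℂ :=
  {z : ℂ | ¬ ∃ R : H →L[ℂ] H, IsResolventAt G z R}

end

/-! In Case II or III all solutions for one spectral parameter are square integrable. A smallness
estimate near `b` carries this over to every parameter (`IsSolution.memLp`), so θ(·,z), φ(·,z) and ψ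
all lie in L²_w. Green's formula expresses a Wronskian of solutions through the integral of their
product, hence ω = [φ,ψ](b) and τ = [θ,ψ](b) exist as finite limits
(`IsSolution.tendsto_wronskian`). If ω were 0, φ would be an eigenfunction of M for z; so ω ≠ 0
(`not_tendsto_wronskian_zero`) and m_n → m = -τ/ω.

With χ = θ + mφ, which satisfies the condition at `b`, variation of constants gives R
(`resolvent_eq_variation`). The same formula with χ replaced by θ + m_n φ, applied to f cut off at
b_n, gives the truncated resolvent (`resolvent_trunc_eq_variation`). Replacing χ by χ + κφ only adds
the rank one operator κT, where Tf = (∫ φ f w) φ (`variation_add_const_mul`). Thus, with P_n the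
cutoff to (-∞, b_n], R_n = (R + (m_n - m) T) P_n, and R_n - R = (m_n - m) T P_n - R (1 - P_n). The
first term vanishes in norm because m_n → m, the second because the kernel of R is dominated by
products of L²_w functions, whose tails vanish (`tendsto_norm_comp_indicatorCLM`). -/

section Primitives

/-! ### Absolute continuity and the product rule for primitives -/

open Set

/-- The primitive of an integrable complex function is absolutely continuous. -/
theorem absolutelyContinuousOnInterval_primitive {f : ℝ → ℂ} {a b : ℝ}
    (h : IntervalIntegrable f volume a b) :
    AbsolutelyContinuousOnInterval (fun x => ∫ v in a..x, f v) a b := by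
  have hn := h.norm.absolutelyContinuousOnInterval_intervalIntegral (c := a) left_mem_uIcc
  -- The oscillation of the primitive is dominated by that of the primitive of `‖f‖`, so absolute
  -- continuity is inherited from the real case.
  have key : ∀ x ∈ uIcc a b, ∀ y ∈ uIcc a b, dist (∫ v in a..x, f v) (∫ v in a..y, f v) ≤
      dist (∫ v in a..x, ‖f v‖) (∫ v in a..y, ‖f v‖) := by
    intro x hx y hy
    have hx' : IntervalIntegrable f volume a x :=
      h.mono_set (uIcc_subset_uIcc left_mem_uIcc hx)
    have hy' : IntervalIntegrable f volume a y :=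
      h.mono_set (uIcc_subset_uIcc left_mem_uIcc hy)
    rw [dist_eq_norm, dist_eq_norm, intervalIntegral.integral_interval_sub_left hx' hy',
      intervalIntegral.integral_interval_sub_left hx'.norm hy'.norm]
    exact intervalIntegral.norm_integral_le_abs_integral_norm
  rw [absolutelyContinuousOnInterval_iff] at hn ⊢
  intro ε hε
  obtain ⟨δ, hδ, H⟩ := hn ε hε
  refine ⟨δ, hδ, fun P hP hlt => lt_of_le_of_lt ?_ (H P hP hlt)⟩
  refine Finset.sum_le_sum fun i hi => ?_
  exact key _ (hP.1 i hi).1 _ (hP.1 i hi).2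

/-- The product rule for primitives of integrable functions. -/
theorem primitive_mul {F G f g : ℝ → ℂ} {a x : ℝ} (hax : a ≤ x)
    (hf : IntervalIntegrable f volume a x) (hg : IntervalIntegrable g volume a x)
    (hF : ∀ t ∈ Icc a x, F t = F a + ∫ s in a..t, f s)
    (hG : ∀ t ∈ Icc a x, G t = G a + ∫ s in a..t, g s) :
    F x * G x = F a * G a + ∫ s in a..x, (f s * G s + F s * g s) := by
  set F' : ℝ → ℂ := fun t => F a + ∫ s in a..t, f s with hF'
  set G' : ℝ → ℂ := fun t => G a + ∫ s in a..t, g s with hG'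
  have hac : ∀ c : ℂ, AbsolutelyContinuousOnInterval (fun _ : ℝ => c) a x := fun c =>
    (LipschitzWith.const c).lipschitzOnWith.absolutelyContinuousOnInterval (K := 0)
  have hFac : AbsolutelyContinuousOnInterval F' a x :=
    (hac (F a)).fun_add (absolutelyContinuousOnInterval_primitive hf)
  have hGac : AbsolutelyContinuousOnInterval G' a x :=
    (hac (G a)).fun_add (absolutelyContinuousOnInterval_primitive hg)
  have hint : IntervalIntegrable (fun s => f s * G' s + F' s * g s) volume a x :=
    (hf.mul_continuousOn hGac.continuousOn).add (hg.continuousOn_mul hFac.continuousOn)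
  -- The product minus its expected primitive is absolutely continuous with derivative zero almost
  -- everywhere, hence constant.
  have hHac : AbsolutelyContinuousOnInterval
      (fun t => F' t * G' t - ∫ s in a..t, (f s * G' s + F' s * g s)) a x :=
    (hFac.fun_smul hGac).fun_sub (absolutelyContinuousOnInterval_primitive hint)
  obtain ⟨C, hC⟩ := hHac.const_of_ae_hasDerivAt_zero (by
    filter_upwards [hf.ae_hasDerivAt_integral, hg.ae_hasDerivAt_integral,
      hint.ae_hasDerivAt_integral] with t h1 h2 h3 ht
    have d1 : HasDerivAt F' (f t) t := (h1 ht a left_mem_uIcc).const_add _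
    have d2 : HasDerivAt G' (g t) t := (h2 ht a left_mem_uIcc).const_add _
    have := (d1.mul d2).sub (h3 ht a left_mem_uIcc)
    rw [sub_self] at this
    exact this)
  have h1 := hC x right_mem_uIcc
  have h2 := hC a left_mem_uIcc
  have e1 : F' x = F x := (hF x (right_mem_Icc.2 hax)).symm
  have e2 : G' x = G x := (hG x (right_mem_Icc.2 hax)).symm
  have e3 : F' a = F a := by simp [hF']
  have e4 : G' a = G a := by simp [hG']
  have e5 : ∫ s in a..x, (f s * G' s + F' s * g s) = ∫ s in a..x, (f s * G s + F s * g s) := by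
    refine intervalIntegral.integral_congr fun t ht => ?_
    rw [uIcc_of_le hax] at ht
    simp only [hF t ht, hG t ht, hF', hG']
  simp only [intervalIntegral.integral_same, sub_zero, e1, e2, e3, e4, e5] at h1 h2
  rw [h2, ← h1]; ring

end Primitives

/-! ### The interval, the weighted measure and local integrability -/

namespace SLExpr

variable (E : SLExpr)

theorem a_mem_I : E.a ∈ E.I := ⟨le_rfl, E.a_lt_b⟩

theorem ordConnected_I : E.I.OrdConnected :=
  ⟨fun _ hx _ hy _ hz => ⟨hx.1.trans hz.1, lt_of_le_of_lt (EReal.coe_le_coe_iff.2 hz.2) hy.2⟩⟩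

theorem measurableSet_I : MeasurableSet E.I := E.ordConnected_I.measurableSet

variable {E}

theorem Icc_subset_I {x : ℝ} (hx : x ∈ E.I) : Set.Icc E.a x ⊆ E.I :=
  E.ordConnected_I.out E.a_mem_I hx

theorem uIcc_subset_I {x : ℝ} (hx : x ∈ E.I) : Set.uIcc E.a x ⊆ E.I := by
  rw [Set.uIcc_of_le hx.1]; exact Icc_subset_I hx

theorem intervalIntegrable_of_locallyIntegrableOn {F : Type*} [NormedAddCommGroup F] {f : ℝ → F}
    (hf : LocallyIntegrableOn f E.I) {x : ℝ} (hx : x ∈ E.I) :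
    IntervalIntegrable f volume E.a x :=
  (hf.integrableOn_compact_subset (uIcc_subset_I hx) isCompact_uIcc).intervalIntegrable

theorem intervalIntegrable_w {x : ℝ} (hx : x ∈ E.I) :
    IntervalIntegrable (fun t => (E.w t : ℂ)) volume E.a x :=
  have h := intervalIntegrable_of_locallyIntegrableOn E.w_loc hx
  ⟨h.1.ofReal, h.2.ofReal⟩

theorem intervalIntegrable_q {x : ℝ} (hx : x ∈ E.I) : IntervalIntegrable E.q volume E.a x :=
  intervalIntegrable_of_locallyIntegrableOn E.q_loc hx

theorem intervalIntegrable_div_p {u : ℝ → ℂ} {x : ℝ} (hx : x ∈ E.I)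
    (hu : ContinuousOn u (Set.Icc E.a x)) :
    IntervalIntegrable (fun t => u t / E.p t) volume E.a x := by
  simp only [div_eq_mul_inv]
  exact (intervalIntegrable_of_locallyIntegrableOn E.inv_p_loc hx).continuousOn_mul
    (by rwa [Set.uIcc_of_le hx.1])

theorem aemeasurable_w {s : Set ℝ} (hs : s ⊆ E.I) : AEMeasurable E.w (volume.restrict s) :=
  (E.w_loc.aestronglyMeasurable.aemeasurable).mono_set hs

theorem ae_w_pos {s : Set ℝ} (hm : MeasurableSet s) (hs : s ⊆ E.I) :
    ∀ᵐ x ∂(volume.restrict s), 0 < E.w x := by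
  rw [ae_restrict_iff' hm]
  filter_upwards [E.w_pos] with x hx hxs using hx (hs hxs)

/-- Since w > 0 almost everywhere, w dx and dx have the same null sets. Statements about classes in
L²_w thereby pass to the differential equation and back. -/
theorem ae_wMeasure {s : Set ℝ} (hm : MeasurableSet s) (hs : s ⊆ E.I) :
    ae (E.wMeasure s) = ae (volume.restrict s) := by
  apply le_antisymm
  · exact (withDensity_absolutelyContinuous _ _).ae_le
  · refine (withDensity_absolutelyContinuous' (aemeasurable_w hs).ennreal_ofReal ?_).ae_le
    filter_upwards [ae_w_pos hm hs] with x hx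
    simpa using hx

theorem wMeasure_restrict {s t : Set ℝ} (ht : MeasurableSet t) (hts : t ⊆ s) :
    (E.wMeasure s).restrict t = E.wMeasure t := by
  rw [wMeasure, wMeasure, restrict_withDensity ht, Measure.restrict_restrict ht,
    Set.inter_eq_left.2 hts]

theorem integrable_wMeasure_iff {s : Set ℝ} (hm : MeasurableSet s) (hs : s ⊆ E.I) {g : ℝ → ℂ} :
    Integrable g (E.wMeasure s) ↔ IntegrableOn (fun x => (E.w x : ℂ) * g x) s := by
  rw [wMeasure, integrable_withDensity_iff_integrable_smul₀'
    (aemeasurable_w hs).ennreal_ofReal (by simp), IntegrableOn]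
  refine integrable_congr ?_
  filter_upwards [ae_w_pos hm hs] with x hx
  simp [ENNReal.toReal_ofReal hx.le]

theorem integral_wMeasure {s : Set ℝ} (hm : MeasurableSet s) (hs : s ⊆ E.I) (g : ℝ → ℂ) :
    ∫ x, g x ∂(E.wMeasure s) = ∫ x in s, (E.w x : ℂ) * g x := by
  rw [wMeasure, integral_withDensity_eq_integral_toReal_smul₀
    (aemeasurable_w hs).ennreal_ofReal (by simp)]
  refine integral_congr_ae ?_
  filter_upwards [ae_w_pos hm hs] with x hx
  simp [ENNReal.toReal_ofReal hx.le]

theorem intervalIntegral_w_mul {x : ℝ} (hx : x ∈ E.I) (g : ℝ → ℂ) :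
    ∫ t in E.a..x, (E.w t : ℂ) * g t = ∫ t in Set.Icc E.a x, g t ∂(E.wMeasure E.I) := by
  rw [wMeasure_restrict measurableSet_Icc (Icc_subset_I hx),
    integral_wMeasure measurableSet_Icc (Icc_subset_I hx),
    intervalIntegral.integral_of_le hx.1, integral_Icc_eq_integral_Ioc]

theorem intervalIntegrable_w_mul {x : ℝ} (hx : x ∈ E.I) {g : ℝ → ℂ}
    (hg : Integrable g (E.wMeasure (Set.Icc E.a x))) :
    IntervalIntegrable (fun t => (E.w t : ℂ) * g t) volume E.a x := by
  rw [integrable_wMeasure_iff measurableSet_Icc (Icc_subset_I hx)] at hg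
  exact (intervalIntegrable_iff_integrableOn_Icc_of_le hx.1).2 hg

theorem integrable_Icc_of_continuousOn {x : ℝ} (hx : x ∈ E.I) {g : ℝ → ℂ}
    (hg : ContinuousOn g (Set.Icc E.a x)) :
    Integrable g (E.wMeasure (Set.Icc E.a x)) := by
  rw [integrable_wMeasure_iff measurableSet_Icc (Icc_subset_I hx)]
  refine (intervalIntegrable_iff_integrableOn_Icc_of_le hx.1).1 ?_
  exact (intervalIntegrable_w hx).mul_continuousOn (by rwa [Set.uIcc_of_le hx.1])

theorem aestronglyMeasurable_of_continuousOn {y : ℝ → ℂ} (hy : ContinuousOn y E.I) :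
    AEStronglyMeasurable y (E.wMeasure E.I) :=
  (hy.aestronglyMeasurable E.measurableSet_I).mono_ac (withDensity_absolutelyContinuous _ _)

theorem memLp_of_sqIntegrable {y : ℝ → ℂ} (hy : ContinuousOn y E.I) (h : E.SqIntegrable y) :
    MemLp y 2 (E.wMeasure E.I) := by
  rw [memLp_two_iff_integrable_sq_norm (aestronglyMeasurable_of_continuousOn hy),
    wMeasure, integrable_withDensity_iff_integrable_smul₀'
    (aemeasurable_w subset_rfl).ennreal_ofReal (by simp)]
  refine (integrable_congr ?_).1 h
  filter_upwards [ae_w_pos E.measurableSet_I subset_rfl] with x hx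
  simp [ENNReal.toReal_ofReal hx.le, mul_comm]

theorem memLp_Icc {g : ℝ → ℂ} (hg : MemLp g 2 (E.wMeasure E.I)) {x : ℝ} (hx : x ∈ E.I) :
    MemLp g 2 (E.wMeasure (Set.Icc E.a x)) := by
  rw [← wMeasure_restrict measurableSet_Icc (Icc_subset_I hx)]
  exact hg.restrict _

end SLExpr

namespace SLExpr

variable {E : SLExpr}

/-! ### Limits at the singular end point -/

section EndPoint

instance : E.atEnd.IsCountablyGenerated := by unfold atEnd; infer_instance

theorem eventually_lt_atEnd {t : ℝ} (ht : (t : EReal) < E.b) :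
    ∀ᶠ x in E.atEnd, t < x ∧ (x : EReal) < E.b := by
  filter_upwards [preimage_mem_comap (Ioo_mem_nhdsLT ht)] with x hx
  exact ⟨EReal.coe_lt_coe_iff.1 hx.1, hx.2⟩

theorem eventually_mem_I : ∀ᶠ x in E.atEnd, x ∈ E.I := by
  filter_upwards [eventually_lt_atEnd E.a_lt_b] with x hx using ⟨hx.1.le, hx.2⟩

instance : E.atEnd.NeBot := by
  refine comap_neBot fun t ht => ?_
  obtain ⟨l, hl, hlt⟩ := (mem_nhdsLT_iff_exists_Ioo_subset' E.a_lt_b).1 ht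
  obtain ⟨x, h1, h2⟩ := EReal.lt_iff_exists_real_btwn.1 hl
  exact ⟨x, hlt ⟨h1, h2⟩⟩

theorem ae_mem_I : ∀ᵐ x ∂(E.wMeasure E.I), x ∈ E.I := by
  rw [ae_wMeasure E.measurableSet_I subset_rfl]
  exact ae_restrict_mem E.measurableSet_I

/-- The measure lives on [a,b), so cutting at x can be done with the complementary half lines `Iic
x` and `Ioi x`. -/
theorem setIntegral_Iic_eq {F : Type*} [NormedAddCommGroup F] [NormedSpace ℝ F] (x : ℝ)
    (g : ℝ → F) :
    ∫ t in Set.Iic x, g t ∂(E.wMeasure E.I) = ∫ t in Set.Icc E.a x, g t ∂(E.wMeasure E.I) := by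
  refine setIntegral_congr_set ?_
  filter_upwards [ae_mem_I] with t ht
  exact propext ⟨fun h => ⟨ht.1, h⟩, fun h => h.2⟩

/-- Dominated convergence: each fixed t leaves `Ioi x` once x has passed t. -/
theorem tendsto_setIntegral_Ioi {F : Type*} [NormedAddCommGroup F] [NormedSpace ℝ F]
    {g : ℝ → F} (hg : Integrable g (E.wMeasure E.I)) :
    Tendsto (fun x => ∫ t in Set.Ioi x, g t ∂(E.wMeasure E.I)) E.atEnd (𝓝 0) := by
  simp only [← integral_indicator measurableSet_Ioi]
  rw [← integral_zero ℝ F (μ := E.wMeasure E.I)]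
  refine tendsto_integral_filter_of_dominated_convergence (fun t => ‖g t‖)
    (Eventually.of_forall fun x => hg.1.indicator measurableSet_Ioi)
    (Eventually.of_forall fun x => Eventually.of_forall fun t => norm_indicator_le_norm_self _ _)
    hg.norm ?_
  filter_upwards [ae_mem_I] with t ht
  refine tendsto_const_nhds.congr' ?_
  filter_upwards [eventually_lt_atEnd ht.2] with x hx
  simp [hx.1.le]

theorem setIntegral_Iic_add_Ioi {F : Type*} [NormedAddCommGroup F] [NormedSpace ℝ F]
    {g : ℝ → F} (hg : Integrable g (E.wMeasure E.I)) (x : ℝ) :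
    ∫ t in Set.Iic x, g t ∂(E.wMeasure E.I) + ∫ t in Set.Ioi x, g t ∂(E.wMeasure E.I) =
      ∫ t, g t ∂(E.wMeasure E.I) :=
  intervalIntegral.integral_Iic_add_Ioi hg.integrableOn hg.integrableOn

theorem tendsto_setIntegral_Iic {F : Type*} [NormedAddCommGroup F] [NormedSpace ℝ F]
    {g : ℝ → F} (hg : Integrable g (E.wMeasure E.I)) :
    Tendsto (fun x => ∫ t in Set.Iic x, g t ∂(E.wMeasure E.I)) E.atEnd
      (𝓝 (∫ t, g t ∂(E.wMeasure E.I))) := by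
  have h := (tendsto_setIntegral_Ioi hg).const_sub (∫ t, g t ∂(E.wMeasure E.I))
  rw [sub_zero] at h
  refine h.congr fun x => ?_
  rw [← setIntegral_Iic_add_Ioi hg x, add_sub_cancel_right]

theorem intervalIntegral_w_mul_eq_Iic {x : ℝ} (hx : x ∈ E.I) (g : ℝ → ℂ) :
    ∫ t in E.a..x, (E.w t : ℂ) * g t = ∫ t in Set.Iic x, g t ∂(E.wMeasure E.I) := by
  rw [intervalIntegral_w_mul hx, setIntegral_Iic_eq]

end EndPoint

/-! ### Green's formula and Wronskians of solutions -/

section GreenFormula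

theorem Solves.mono {s t : Set ℝ} {g y u : ℝ → ℂ} (h : E.Solves s g y u) (hts : t ⊆ s) :
    E.Solves t g y u :=
  ⟨h.1.mono hts, h.2.1.mono hts, fun x hx => h.2.2 x (hts hx)⟩

/-- The right-hand side enters only under an integral. This allows it to be a representative of an
`Lp` class. -/
theorem Solves.congr {s : Set ℝ} (hs : ∀ x ∈ s, Set.Icc E.a x ⊆ s) (hm : MeasurableSet s)
    (ha : ∀ x ∈ s, E.a ≤ x) {g g' y u : ℝ → ℂ}
    (h : E.Solves s g y u) (hg : g =ᵐ[volume.restrict s] g') : E.Solves s g' y u := by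
  refine ⟨h.1, h.2.1, fun x hx => ⟨(h.2.2 x hx).1, ?_⟩⟩
  rw [(h.2.2 x hx).2]
  congr 1
  refine intervalIntegral.integral_congr_ae ?_
  rw [EventuallyEq, ae_restrict_iff' hm] at hg
  filter_upwards [hg] with t ht hmem
  rw [Set.uIoc_of_le (ha x hx)] at hmem
  rw [ht (hs x hx ⟨hmem.1.le, hmem.2⟩)]

theorem Solves.intervalIntegrable_rhs {x : ℝ} (hx : x ∈ E.I) {g y u : ℝ → ℂ}
    (h : E.Solves (Set.Icc E.a x) g y u) (hg : Integrable g (E.wMeasure (Set.Icc E.a x))) :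
    IntervalIntegrable (fun t => E.q t * y t - (E.w t : ℂ) * g t) volume E.a x :=
  ((intervalIntegrable_q hx).mul_continuousOn (by rw [Set.uIcc_of_le hx.1]; exact h.1)).sub
    (intervalIntegrable_w_mul hx hg)

/-- Green's formula on `[a, x]`. -/
theorem wronskian_eq_add_integral {x : ℝ} (hx : x ∈ E.I) {g y u k v v₁ : ℝ → ℂ}
    (h : E.Solves (Set.Icc E.a x) g y u) (h' : E.Solves (Set.Icc E.a x) k v v₁)
    (hg : Integrable g (E.wMeasure (Set.Icc E.a x)))
    (hk : Integrable k (E.wMeasure (Set.Icc E.a x))) :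
    wronskian y u v v₁ x = wronskian y u v v₁ E.a +
      ∫ t in E.a..x, (E.w t : ℂ) * (g t * v t - y t * k t) := by
  have iu := intervalIntegrable_div_p hx h.2.1
  have iv := intervalIntegrable_div_p hx h'.2.1
  have iy := h.intervalIntegrable_rhs hx hg
  have ik := h'.intervalIntegrable_rhs hx hk
  have e1 := primitive_mul hx.1 iu ik (fun t ht => (h.2.2 t ht).1) (fun t ht => (h'.2.2 t ht).2)
  have e2 := primitive_mul hx.1 iy iv (fun t ht => (h.2.2 t ht).2) (fun t ht => (h'.2.2 t ht).1)
  have cu := Set.uIcc_of_le hx.1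
  rw [wronskian, e1, e2, wronskian, add_sub_add_comm, ← intervalIntegral.integral_sub]
  · congr 1
    refine intervalIntegral.integral_congr fun t _ => ?_
    ring
  · exact (iu.mul_continuousOn (by rw [cu]; exact h'.2.1)).add
      (ik.continuousOn_mul (by rw [cu]; exact h.1))
  · exact (iy.mul_continuousOn (by rw [cu]; exact h'.1)).add
      (iv.continuousOn_mul (by rw [cu]; exact h.2.1))

theorem IsSolution.wronskian_eq {l m : ℂ} {y u v v₁ : ℝ → ℂ} (hy : E.IsSolution l y u)
    (hv : E.IsSolution m v v₁) {x : ℝ} (hx : x ∈ E.I) :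
    wronskian y u v v₁ x = wronskian y u v v₁ E.a +
      (l - m) * ∫ t in Set.Iic x, y t * v t ∂(E.wMeasure E.I) := by
  have h := Solves.mono hy (Icc_subset_I hx)
  have h' := Solves.mono hv (Icc_subset_I hx)
  rw [wronskian_eq_add_integral hx h h' (integrable_Icc_of_continuousOn hx (h.1.const_mul l))
    (integrable_Icc_of_continuousOn hx (h'.1.const_mul m)), ← intervalIntegral_w_mul_eq_Iic hx,
    ← intervalIntegral.integral_const_mul]
  congr 1
  refine intervalIntegral.integral_congr fun t _ => ?_
  ring

theorem IsSolution.wronskian_const {l : ℂ} {y u v v₁ : ℝ → ℂ} (hy : E.IsSolution l y u)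
    (hv : E.IsSolution l v v₁) {x : ℝ} (hx : x ∈ E.I) :
    wronskian y u v v₁ x = wronskian y u v v₁ E.a := by
  rw [hy.wronskian_eq hv hx, sub_self, zero_mul, add_zero]

theorem IsSolution.add_const_mul {l : ℂ} {y u v v₁ : ℝ → ℂ} (hy : E.IsSolution l y u)
    (hv : E.IsSolution l v v₁) (c : ℂ) :
    E.IsSolution l (fun x => y x + c * v x) (fun x => u x + c * v₁ x) := by
  refine ⟨hy.1.add (hv.1.const_mul c), hy.2.1.add (hv.2.1.const_mul c), fun x hx => ?_⟩
  have h := Solves.mono hy (Icc_subset_I hx)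
  have h' := Solves.mono hv (Icc_subset_I hx)
  beta_reduce
  constructor
  · rw [(hy.2.2 x hx).1, (hv.2.2 x hx).1]
    have : ∫ t in E.a..x, (u t + c * v₁ t) / E.p t =
        (∫ t in E.a..x, u t / E.p t) + c * ∫ t in E.a..x, v₁ t / E.p t := by
      rw [← intervalIntegral.integral_const_mul, ← intervalIntegral.integral_add
        (intervalIntegrable_div_p hx h.2.1) ((intervalIntegrable_div_p hx h'.2.1).const_mul c)]
      refine intervalIntegral.integral_congr fun t _ => ?_
      ring
    rw [this]; ring
  · rw [(hy.2.2 x hx).2, (hv.2.2 x hx).2]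
    have : ∫ t in E.a..x, (E.q t * (y t + c * v t) - (E.w t : ℂ) * (l * (y t + c * v t))) =
        (∫ t in E.a..x, (E.q t * y t - (E.w t : ℂ) * (l * y t))) +
          c * ∫ t in E.a..x, (E.q t * v t - (E.w t : ℂ) * (l * v t)) := by
      rw [← intervalIntegral.integral_const_mul, ← intervalIntegral.integral_add
        (h.intervalIntegrable_rhs hx (integrable_Icc_of_continuousOn hx (h.1.const_mul l)))
        ((h'.intervalIntegrable_rhs hx
          (integrable_Icc_of_continuousOn hx (h'.1.const_mul l))).const_mul c)]
      refine intervalIntegral.integral_congr fun t _ => ?_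
      ring
    rw [this]; ring

end GreenFormula

/-! ### Square integrability for every spectral parameter -/

section SquareIntegrability

theorem integrable_mul_of_memLp {f g : ℝ → ℂ} (hf : MemLp f 2 (E.wMeasure E.I))
    (hg : MemLp g 2 (E.wMeasure E.I)) : Integrable (fun t => f t * g t) (E.wMeasure E.I) :=
  hf.integrable_mul hg

/-- If a fundamental system of solutions for the spectral parameter `l` is in `L²_w[a, b)`, then so
is every solution for every other spectral parameter. -/
theorem IsSolution.memLp {l z : ℂ} {θ θ₁ φ φ₁ y u : ℝ → ℂ} (hθ : E.IsSolution l θ θ₁)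
    (hφ : E.IsSolution l φ φ₁) (hW : wronskian φ φ₁ θ θ₁ E.a = 1)
    (hθ2 : MemLp θ 2 (E.wMeasure E.I)) (hφ2 : MemLp φ 2 (E.wMeasure E.I))
    (hy : E.IsSolution z y u) : MemLp y 2 (E.wMeasure E.I) := by
  set μ := E.wMeasure E.I with hμ
  set A : ℝ → ℝ := fun t => ‖θ t‖ + ‖φ t‖ with hA
  have hA0 : ∀ t, 0 ≤ A t := fun t => by positivity
  have hA2 : MemLp A 2 μ := hθ2.norm.add hφ2.norm
  have hAi : Integrable (fun t => A t * A t) μ := hA2.integrable_mul hA2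
  set B : ℝ → ℝ := fun t => ‖wronskian y u θ θ₁ t‖ + ‖wronskian y u φ φ₁ t‖ with hB
  have hB0 : ∀ t, 0 ≤ B t := fun t => by positivity
  have hBc : ContinuousOn B E.I :=
    (((hy.1.mul hθ.2.1).sub (hy.2.1.mul hθ.1)).norm).add
      (((hy.1.mul hφ.2.1).sub (hy.2.1.mul hφ.1)).norm)
  have hyB : ∀ t ∈ E.I, ‖y t‖ ≤ A t * B t := by
    intro t ht
    -- Since [φ,θ] = 1, y is a combination of θ and φ whose coefficients are its Wronskians with
    -- them. It remains to bound these, that is `B`.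
    have e : y t = φ t * wronskian y u θ θ₁ t - θ t * wronskian y u φ φ₁ t := by
      have h1 := hφ.wronskian_const hθ ht
      rw [hW] at h1
      calc y t = y t * wronskian φ φ₁ θ θ₁ t := by rw [h1, mul_one]
        _ = _ := by simp only [wronskian]; ring
    rw [e]
    refine (norm_sub_le _ _).trans ?_
    rw [norm_mul, norm_mul, hA, hB]
    nlinarith [norm_nonneg (φ t), norm_nonneg (θ t), norm_nonneg (wronskian y u θ θ₁ t),
      norm_nonneg (wronskian y u φ φ₁ t), mul_nonneg (norm_nonneg (φ t))
      (norm_nonneg (wronskian y u φ φ₁ t)), mul_nonneg (norm_nonneg (θ t))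
      (norm_nonneg (wronskian y u θ θ₁ t))]
  -- Beyond this c the tail of ∫ A² w is so small that Green's formula changes `B` by at most half
  -- of its supremum, which can then be absorbed.
  obtain ⟨c, hcI, hc⟩ : ∃ c ∈ E.I, ‖z - l‖ * ∫ t in Set.Ioi c, A t * A t ∂μ ≤ 1 / 2 := by
    have h := (tendsto_setIntegral_Ioi hAi).const_mul ‖z - l‖
    rw [mul_zero] at h
    exact ((eventually_mem_I.and (h.eventually (eventually_le_nhds (by norm_num)))).exists)
  have hmono : ∀ X ∈ E.I, ∀ S : ℝ, 0 ≤ S → (∀ t ∈ Set.Icc c X, B t ≤ S) →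
      ∀ x ∈ Set.Icc c X, B x ≤ B c + S / 2 := by
    intro X hX S hS hBS x hx
    have hxI : x ∈ E.I := E.ordConnected_I.out hcI hX hx
    have hsub : Set.Ioc c x ⊆ E.I := fun t ht =>
      E.ordConnected_I.out hcI hxI ⟨ht.1.le, ht.2⟩
    have hcont : ∀ v : ℝ → ℂ, ContinuousOn v E.I →
        IntegrableOn (fun t => y t * v t) (Set.Iic x) μ := by
      intro v hv
      have : Integrable (fun t => y t * v t) (E.wMeasure (Set.Icc E.a x)) :=
        integrable_Icc_of_continuousOn hxI ((hy.1.mul hv).mono (Icc_subset_I hxI))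
      rw [← wMeasure_restrict measurableSet_Icc (Icc_subset_I hxI)] at this
      refine IntegrableOn.congr_set_ae this ?_
      filter_upwards [ae_mem_I] with t ht
      exact propext ⟨fun h => ⟨ht.1, h⟩, fun h => h.2⟩
    have hdiff : ∀ v v₁ : ℝ → ℂ, E.IsSolution l v v₁ →
        wronskian y u v v₁ x = wronskian y u v v₁ c +
          (z - l) * ∫ t in Set.Ioc c x, y t * v t ∂μ := by
      intro v v₁ hv
      have hi := hcont v hv.1
      have e : ∫ t in Set.Iic x, y t * v t ∂μ = ∫ t in Set.Iic c, y t * v t ∂μ +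
          ∫ t in Set.Ioc c x, y t * v t ∂μ := by
        rw [← Set.Iic_union_Ioc_eq_Iic hx.1]
        exact setIntegral_union (Set.Iic_disjoint_Ioc le_rfl) measurableSet_Ioc
          (hi.mono_set (Set.Iic_subset_Iic.2 hx.1)) (hi.mono_set Set.Ioc_subset_Iic_self)
      rw [hy.wronskian_eq hv hxI, hy.wronskian_eq hv hcI, e]
      ring
    have hint : ∀ v : ℝ → ℂ, ContinuousOn v E.I →
        IntegrableOn (fun t => ‖y t‖ * ‖v t‖) (Set.Ioc c x) μ := by
      intro v hv
      simpa only [IntegrableOn, norm_mul] using ((hcont v hv).mono_set Set.Ioc_subset_Iic_self).norm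
    have hsum : ‖∫ t in Set.Ioc c x, y t * θ t ∂μ‖ + ‖∫ t in Set.Ioc c x, y t * φ t ∂μ‖ ≤
        S * ∫ t in Set.Ioi c, A t * A t ∂μ := by
      calc _ ≤ ∫ t in Set.Ioc c x, ‖y t‖ * ‖θ t‖ ∂μ + ∫ t in Set.Ioc c x, ‖y t‖ * ‖φ t‖ ∂μ := by
            simp only [← norm_mul]
            exact add_le_add (norm_integral_le_integral_norm _) (norm_integral_le_integral_norm _)
        _ = ∫ t in Set.Ioc c x, ‖y t‖ * A t ∂μ := by
            rw [← integral_add (hint θ hθ.1) (hint φ hφ.1)]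
            simp only [hA, mul_add]
        _ ≤ ∫ t in Set.Ioc c x, S * (A t * A t) ∂μ := by
            refine setIntegral_mono_on ?_ (hAi.integrableOn.const_mul S) measurableSet_Ioc ?_
            · have := (hint θ hθ.1).add (hint φ hφ.1)
              refine this.congr (Eventually.of_forall fun t => ?_)
              simp [hA, mul_add]
            · intro t ht
              have h1 := hyB t (hsub ht)
              have h2 := hBS t ⟨ht.1.le, ht.2.trans hx.2⟩
              calc ‖y t‖ * A t ≤ (A t * S) * A t :=
                    mul_le_mul_of_nonneg_right
                      (h1.trans (mul_le_mul_of_nonneg_left h2 (hA0 t))) (hA0 t)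
                _ = S * (A t * A t) := by ring
        _ ≤ S * ∫ t in Set.Ioi c, A t * A t ∂μ := by
            rw [integral_const_mul]
            refine mul_le_mul_of_nonneg_left ?_ hS
            exact setIntegral_mono_set hAi.integrableOn
              (Eventually.of_forall fun t => mul_nonneg (hA0 t) (hA0 t))
              (Eventually.of_forall fun t ht => ht.1)
    have h1 : ‖wronskian y u θ θ₁ x‖ ≤ ‖wronskian y u θ θ₁ c‖ +
        ‖z - l‖ * ‖∫ t in Set.Ioc c x, y t * θ t ∂μ‖ := by
      rw [hdiff θ θ₁ hθ, ← norm_mul]; exact norm_add_le _ _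
    have h2 : ‖wronskian y u φ φ₁ x‖ ≤ ‖wronskian y u φ φ₁ c‖ +
        ‖z - l‖ * ‖∫ t in Set.Ioc c x, y t * φ t ∂μ‖ := by
      rw [hdiff φ φ₁ hφ, ← norm_mul]; exact norm_add_le _ _
    have h3 := mul_le_mul_of_nonneg_left hsum (norm_nonneg (z - l))
    have h4 := mul_le_mul_of_nonneg_left hc hS
    simp only [hB]
    linarith
  have hBbound : ∀ X ∈ E.I, c ≤ X → B X ≤ 2 * B c := by
    intro X hX hcX
    obtain ⟨x₀, hx₀, hmax⟩ := isCompact_Icc.exists_isMaxOn (Set.nonempty_Icc.2 hcX)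
      (hBc.mono (E.ordConnected_I.out hcI hX))
    -- Taking S to be the maximum B x₀ on [c,X] gives B x₀ ≤ B c + B x₀ / 2, a bound by 2 B c
    -- independent of X.
    have h := hmono X hX (B x₀) (hB0 _) (fun t ht => hmax ht) x₀ hx₀
    have := hmax (Set.right_mem_Icc.2 hcX)
    simp only [Set.mem_ofPred_eq] at this
    linarith
  obtain ⟨C, hC⟩ := isCompact_Icc.exists_bound_of_continuousOn (hBc.mono (Icc_subset_I hcI))
  have hC' : ∀ t ∈ E.I, B t ≤ max C (2 * B c) := by
    intro t ht
    rcases le_total t c with h | h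
    · exact (le_abs_self _).trans ((hC t ⟨ht.1, h⟩).trans (le_max_left _ _))
    · exact (hBbound t ht h).trans (le_max_right _ _)
  refine (hA2.const_mul (max C (2 * B c))).mono' (aestronglyMeasurable_of_continuousOn hy.1) ?_
  filter_upwards [ae_mem_I] with t ht
  calc ‖y t‖ ≤ A t * B t := hyB t ht
    _ ≤ A t * max C (2 * B c) := mul_le_mul_of_nonneg_left (hC' t ht) (hA0 t)
    _ = _ := mul_comm _ _

end SquareIntegrability

end SLExpr

noncomputable section

/-! ### Cauchy-Schwarz, cutoffs and pairings on L² -/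

section L2

variable {X : Type*} [MeasurableSpace X] {μ : Measure X}

/-- The Cauchy-Schwarz inequality for square integrable complex functions. -/
theorem integral_norm_mul_le_sqrt {f g : X → ℂ} (hf : MemLp f 2 μ) (hg : MemLp g 2 μ) :
    ∫ x, ‖f x * g x‖ ∂μ ≤ √(∫ x, ‖f x‖ ^ 2 ∂μ) * √(∫ x, ‖g x‖ ^ 2 ∂μ) := by
  have h := integral_mul_norm_le_Lp_mul_Lq (μ := μ) (f := f) (g := g) Real.HolderConjugate.two_two
    (by simpa using hf) (by simpa using hg)
  simpa only [norm_mul, Real.sqrt_eq_rpow, Real.rpow_ofNat] using h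

theorem norm_eq_sqrt_integral (f : Lp ℂ 2 μ) : ‖f‖ = √(∫ x, ‖f x‖ ^ 2 ∂μ) := by
  rw [Lp.norm_def, (Lp.memLp f).eLpNorm_eq_integral_rpow_norm two_ne_zero ENNReal.ofNat_ne_top,
    ENNReal.toReal_ofReal (by positivity), Real.sqrt_eq_rpow]
  simp

/-- Multiplication by the indicator function of `s`. -/
def indicatorCLM (μ : Measure X) {s : Set X} (hs : MeasurableSet s) :
    Lp ℂ 2 μ →L[ℂ] Lp ℂ 2 μ :=
  LinearMap.mkContinuous
    { toFun := fun f => ((Lp.memLp f).indicator hs).toLp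
      map_add' := fun f g => by
        rw [← MemLp.toLp_add, MemLp.toLp_eq_toLp_iff]
        filter_upwards [Lp.coeFn_add f g] with x hx
        by_cases h : x ∈ s
        · simpa only [Set.indicator_of_mem h, Pi.add_apply] using hx
        · simp [h]
      map_smul' := fun c f => by
        rw [RingHom.id_apply, ← MemLp.toLp_const_smul, MemLp.toLp_eq_toLp_iff]
        filter_upwards [Lp.coeFn_smul c f] with x hx
        by_cases h : x ∈ s
        · simpa only [Set.indicator_of_mem h, Pi.smul_apply] using hx
        · simp [h] } 1
    (fun f => by
      refine Lp.norm_le_mul_norm_of_ae_le_mul ?_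
      filter_upwards [((Lp.memLp f).indicator hs).coeFn_toLp] with x hx
      simp only [LinearMap.coe_mk, AddHom.coe_mk]
      rw [hx, one_mul]
      exact norm_indicator_le_norm_self _ _)

theorem coeFn_indicatorCLM {s : Set X} (hs : MeasurableSet s) (f : Lp ℂ 2 μ) :
    indicatorCLM μ hs f =ᵐ[μ] s.indicator f :=
  ((Lp.memLp f).indicator hs).coeFn_toLp

theorem norm_indicatorCLM_le {s : Set X} (hs : MeasurableSet s) : ‖indicatorCLM μ hs‖ ≤ 1 :=
  LinearMap.mkContinuous_norm_le _ zero_le_one _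

/-- The functional `f ↦ ∫ φ f dμ`. -/
def pairingCLM {φ : X → ℂ} (hφ : MemLp φ 2 μ) : Lp ℂ 2 μ →L[ℂ] ℂ :=
  -- The conjugate compensates for the inner product being conjugate linear in its first argument;
  -- the pairing involves no conjugation.
  innerSL ℂ (hφ.star.toLp (star φ))

theorem pairingCLM_apply {φ : X → ℂ} (hφ : MemLp φ 2 μ) (f : Lp ℂ 2 μ) :
    pairingCLM hφ f = ∫ x, φ x * f x ∂μ := by
  rw [pairingCLM, innerSL_apply_apply, L2.inner_def]
  refine integral_congr_ae ?_
  filter_upwards [hφ.star.coeFn_toLp] with x hx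
  rw [hx]
  simp [mul_comm]

end L2

namespace SLExpr

variable {E : SLExpr}

/-! ### The partial integrals in the variation of constants formula -/

section Coefficients

/-- The integral `∫_a^x v f w`. -/
def lowerCoeff (E : SLExpr) (v f : ℝ → ℂ) (x : ℝ) : ℂ :=
  ∫ t in Set.Iic x, v t * f t ∂(E.wMeasure E.I)

/-- The integral `∫_x^b v f w`. -/
def upperCoeff (E : SLExpr) (v f : ℝ → ℂ) (x : ℝ) : ℂ :=
  ∫ t in Set.Ioi x, v t * f t ∂(E.wMeasure E.I)

theorem lowerCoeff_eq_integral {x : ℝ} (hx : x ∈ E.I) (v f : ℝ → ℂ) :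
    E.lowerCoeff v f x = ∫ t in E.a..x, (E.w t : ℂ) * (v t * f t) :=
  (intervalIntegral_w_mul_eq_Iic hx _).symm

theorem lowerCoeff_a (v f : ℝ → ℂ) : E.lowerCoeff v f E.a = 0 := by
  rw [lowerCoeff_eq_integral E.a_mem_I, intervalIntegral.integral_same]

theorem upperCoeff_eq_sub {v f : ℝ → ℂ} (h : Integrable (fun t => v t * f t) (E.wMeasure E.I))
    (x : ℝ) : E.upperCoeff v f x = ∫ t, v t * f t ∂(E.wMeasure E.I) - E.lowerCoeff v f x := by
  rw [← setIntegral_Iic_add_Ioi h x, lowerCoeff, upperCoeff, add_sub_cancel_left]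

theorem norm_setIntegral_le_integral_norm {g : ℝ → ℂ} (h : Integrable g (E.wMeasure E.I))
    (s : Set ℝ) :
    ‖∫ t in s, g t ∂(E.wMeasure E.I)‖ ≤ ∫ t, ‖g t‖ ∂(E.wMeasure E.I) :=
  (norm_integral_le_integral_norm _).trans
    (setIntegral_le_integral h.norm (Eventually.of_forall fun _ => norm_nonneg _))

theorem exists_mem_I_gt {x : ℝ} (hx : x ∈ E.I) : ∃ c ∈ E.I, x < c := by
  obtain ⟨c, h1, h2⟩ := EReal.lt_iff_exists_real_btwn.1 hx.2
  have h1' := EReal.coe_lt_coe_iff.1 h1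
  exact ⟨c, ⟨hx.1.trans h1'.le, h2⟩, h1'⟩

theorem continuousOn_I_of_forall_Icc {F : ℝ → ℂ}
    (h : ∀ c ∈ E.I, ContinuousOn F (Set.Icc E.a c)) : ContinuousOn F E.I := by
  intro x hx
  obtain ⟨c, hc, hxc⟩ := exists_mem_I_gt hx
  refine (h c hc x ⟨hx.1, hxc.le⟩).mono_of_mem_nhdsWithin ?_
  filter_upwards [self_mem_nhdsWithin, mem_nhdsWithin_of_mem_nhds (Iio_mem_nhds hxc)] with t h1 h2
  exact ⟨h1.1, le_of_lt h2⟩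

theorem continuousOn_lowerCoeff {v f : ℝ → ℂ}
    (h : Integrable (fun t => v t * f t) (E.wMeasure E.I)) :
    ContinuousOn (E.lowerCoeff v f) E.I := by
  refine continuousOn_I_of_forall_Icc fun c hc => ?_
  have hi : Integrable (fun t => v t * f t) (E.wMeasure (Set.Icc E.a c)) := by
    rw [← wMeasure_restrict measurableSet_Icc (Icc_subset_I hc)]
    exact h.restrict
  have h1 := intervalIntegral.continuousOn_primitive_interval' (intervalIntegrable_w_mul hc hi)
    Set.left_mem_uIcc
  rw [Set.uIcc_of_le hc.1] at h1
  exact h1.congr fun t ht => lowerCoeff_eq_integral (Icc_subset_I hc ht) _ _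

theorem continuousOn_upperCoeff {v f : ℝ → ℂ}
    (h : Integrable (fun t => v t * f t) (E.wMeasure E.I)) :
    ContinuousOn (E.upperCoeff v f) E.I :=
  (continuousOn_const.sub (continuousOn_lowerCoeff h)).congr fun t _ => upperCoeff_eq_sub h t

end Coefficients

/-! ### Variation of constants -/

section VariationOfConstants

/-- The function `y ∫_x^b χ f w + v ∫_a^x φ f w`. For `y = φ`, `v = χ` it is a solution of the
inhomogeneous equation, for `y = p φ'`, `v = p χ'` the quasi-derivative of that solution. -/
def variation (E : SLExpr) (φ χ y v f : ℝ → ℂ) (x : ℝ) : ℂ :=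
  y x * E.upperCoeff χ f x + v x * E.lowerCoeff φ f x

variable {z : ℂ} {φ φ₁ χ χ₁ f : ℝ → ℂ}

/-- Variation of constants for the equation `(z - M) y = f`. -/
theorem solves_variation (hφ : E.IsSolution z φ φ₁) (hχ : E.IsSolution z χ χ₁)
    (hW : wronskian φ φ₁ χ χ₁ E.a = 1) (hφ2 : MemLp φ 2 (E.wMeasure E.I))
    (hχ2 : MemLp χ 2 (E.wMeasure E.I)) (hf : MemLp f 2 (E.wMeasure E.I)) :
    E.Solves E.I (fun t => z * E.variation φ χ φ χ f t - f t)
      (E.variation φ χ φ χ f) (E.variation φ χ φ₁ χ₁ f) := by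
  have hφf := integrable_mul_of_memLp hφ2 hf
  have hχf := integrable_mul_of_memLp hχ2 hf
  set A := E.lowerCoeff φ f with hA
  set B := E.upperCoeff χ f with hB
  have cA : ContinuousOn A E.I := continuousOn_lowerCoeff hφf
  have cB : ContinuousOn B E.I := continuousOn_upperCoeff hχf
  refine ⟨(hφ.1.mul cB).add (hχ.1.mul cA), (hφ.2.1.mul cB).add (hχ.2.1.mul cA), fun x hx => ?_⟩
  have hsub := Icc_subset_I hx
  have cu := Set.uIcc_of_le hx.1
  have h := Solves.mono hφ hsub
  have h' := Solves.mono hχ hsub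
  have iA : IntervalIntegrable (fun t => (E.w t : ℂ) * (φ t * f t)) volume E.a x := by
    refine intervalIntegrable_w_mul hx ?_
    rw [← wMeasure_restrict measurableSet_Icc hsub]
    exact hφf.restrict
  have iB : IntervalIntegrable (fun t => -((E.w t : ℂ) * (χ t * f t))) volume E.a x := by
    refine (intervalIntegrable_w_mul hx ?_).neg
    rw [← wMeasure_restrict measurableSet_Icc hsub]
    exact hχf.restrict
  have pA : ∀ t ∈ Set.Icc E.a x, A t = A E.a + ∫ s in E.a..t, (E.w s : ℂ) * (φ s * f s) := by
    intro t ht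
    rw [hA, lowerCoeff_a, zero_add, lowerCoeff_eq_integral (hsub ht)]
  have pB : ∀ t ∈ Set.Icc E.a x,
      B t = B E.a + ∫ s in E.a..t, -((E.w s : ℂ) * (χ s * f s)) := by
    intro t ht
    rw [intervalIntegral.integral_neg, ← lowerCoeff_eq_integral (hsub ht)]
    simp only [hB, upperCoeff_eq_sub hχf, lowerCoeff_a]
    ring
  have iφ := intervalIntegrable_div_p hx h.2.1
  have iχ := intervalIntegrable_div_p hx h'.2.1
  have iφ₁ := h.intervalIntegrable_rhs hx (integrable_Icc_of_continuousOn hx (h.1.const_mul z))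
  have iχ₁ := h'.intervalIntegrable_rhs hx (integrable_Icc_of_continuousOn hx (h'.1.const_mul z))
  have kA : ContinuousOn A (Set.uIcc E.a x) := by rw [cu]; exact cA.mono hsub
  have kB : ContinuousOn B (Set.uIcc E.a x) := by rw [cu]; exact cB.mono hsub
  have kφ : ContinuousOn φ (Set.uIcc E.a x) := by rw [cu]; exact h.1
  have kφ₁ : ContinuousOn φ₁ (Set.uIcc E.a x) := by rw [cu]; exact h.2.1
  have kχ : ContinuousOn χ (Set.uIcc E.a x) := by rw [cu]; exact h'.1
  have kχ₁ : ContinuousOn χ₁ (Set.uIcc E.a x) := by rw [cu]; exact h'.2.1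
  have pφ : ∀ t ∈ Set.Icc E.a x, _ := fun t ht => (h.2.2 t ht).1
  have pφ₁ : ∀ t ∈ Set.Icc E.a x, _ := fun t ht => (h.2.2 t ht).2
  have pχ : ∀ t ∈ Set.Icc E.a x, _ := fun t ht => (h'.2.2 t ht).1
  have pχ₁ : ∀ t ∈ Set.Icc E.a x, _ := fun t ht => (h'.2.2 t ht).2
  constructor
  · have e1 := primitive_mul hx.1 iφ iB pφ pB
    have e2 := primitive_mul hx.1 iχ iA pχ pA
    change φ x * B x + χ x * A x = φ E.a * B E.a + χ E.a * A E.a +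
      ∫ t in E.a..x, (φ₁ t * B t + χ₁ t * A t) / E.p t
    rw [e1, e2, add_add_add_comm, ← intervalIntegral.integral_add
      ((iφ.mul_continuousOn kB).add (iB.continuousOn_mul kφ))
      ((iχ.mul_continuousOn kA).add (iA.continuousOn_mul kχ))]
    congr 1
    -- The terms from differentiating the coefficients, -φχfw and χφfw, cancel.
    refine intervalIntegral.integral_congr fun t _ => ?_
    ring
  · have e1 := primitive_mul hx.1 iφ₁ iB pφ₁ pB
    have e2 := primitive_mul hx.1 iχ₁ iA pχ₁ pA
    change φ₁ x * B x + χ₁ x * A x = φ₁ E.a * B E.a + χ₁ E.a * A E.a +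
      ∫ t in E.a..x, (E.q t * (φ t * B t + χ t * A t) -
        (E.w t : ℂ) * (z * (φ t * B t + χ t * A t) - f t))
    rw [e1, e2, add_add_add_comm, ← intervalIntegral.integral_add
      ((iφ₁.mul_continuousOn kB).add (iB.continuousOn_mul kφ₁))
      ((iχ₁.mul_continuousOn kA).add (iA.continuousOn_mul kχ₁))]
    congr 1
    refine intervalIntegral.integral_congr fun t ht => ?_
    rw [cu] at ht
    -- Here those terms add up to f w [φ,χ], and [φ,χ] = 1 produces the inhomogeneity.
    have hWt := hφ.wronskian_const hχ (hsub ht)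
    rw [hW, wronskian] at hWt
    linear_combination ((E.w t : ℂ) * f t) * hWt

/-- Both coefficients are at most integrals over all of [a,b), so the bound is a constant depending
on f times a fixed L²_w function. It serves for membership in L²_w and for the operator norm
estimate. -/
theorem norm_variation_le (hφ2 : MemLp φ 2 (E.wMeasure E.I))
    (hχ2 : MemLp χ 2 (E.wMeasure E.I)) (hf : MemLp f 2 (E.wMeasure E.I)) (x : ℝ) :
    ‖E.variation φ χ φ χ f x‖ ≤
      (∫ t, ‖χ t * f t‖ ∂(E.wMeasure E.I) + ∫ t, ‖φ t * f t‖ ∂(E.wMeasure E.I)) *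
        ‖‖φ x‖ + ‖χ x‖‖ := by
  have h1 : ‖E.lowerCoeff φ f x‖ ≤ ∫ t, ‖φ t * f t‖ ∂(E.wMeasure E.I) :=
    norm_setIntegral_le_integral_norm (integrable_mul_of_memLp hφ2 hf) _
  have h2 : ‖E.upperCoeff χ f x‖ ≤ ∫ t, ‖χ t * f t‖ ∂(E.wMeasure E.I) :=
    norm_setIntegral_le_integral_norm (integrable_mul_of_memLp hχ2 hf) _
  set P := ∫ t, ‖φ t * f t‖ ∂(E.wMeasure E.I)
  set S := ∫ t, ‖χ t * f t‖ ∂(E.wMeasure E.I)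
  have hP : 0 ≤ P := (norm_nonneg _).trans h1
  have hS : 0 ≤ S := (norm_nonneg _).trans h2
  rw [Real.norm_of_nonneg (by positivity : 0 ≤ ‖φ x‖ + ‖χ x‖), variation]
  calc _ ≤ ‖φ x‖ * ‖E.upperCoeff χ f x‖ + ‖χ x‖ * ‖E.lowerCoeff φ f x‖ := by
        rw [← norm_mul, ← norm_mul]; exact norm_add_le _ _
    _ ≤ ‖φ x‖ * S + ‖χ x‖ * P := by gcongr
    _ ≤ _ := by nlinarith [mul_nonneg (norm_nonneg (φ x)) hP, mul_nonneg (norm_nonneg (χ x)) hS]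

theorem memLp_variation (hφ : E.IsSolution z φ φ₁) (hχ : E.IsSolution z χ χ₁)
    (hW : wronskian φ φ₁ χ χ₁ E.a = 1) (hφ2 : MemLp φ 2 (E.wMeasure E.I))
    (hχ2 : MemLp χ 2 (E.wMeasure E.I)) (hf : MemLp f 2 (E.wMeasure E.I)) :
    MemLp (E.variation φ χ φ χ f) 2 (E.wMeasure E.I) :=
  ((hφ2.norm.add hχ2.norm).norm.const_mul _).mono' (aestronglyMeasurable_of_continuousOn
    (solves_variation hφ hχ hW hφ2 hχ2 hf).1)
    (Eventually.of_forall fun x => norm_variation_le hφ2 hχ2 hf x)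

/-- The variation of constants in terms of the Green's function. -/
theorem variation_eq_integral_green (hφ2 : MemLp φ 2 (E.wMeasure E.I))
    (hχ2 : MemLp χ 2 (E.wMeasure E.I)) (hf : MemLp f 2 (E.wMeasure E.I)) (x : ℝ) :
    E.variation φ χ φ χ f x =
      ∫ t, green φ χ x t * f t ∂(E.wMeasure E.I) := by
  have g1 : ∀ t ∈ Set.Iic x, green φ χ x t * f t = χ x * (φ t * f t) := by
    intro t ht
    rw [green, if_neg (not_lt.2 ht)]; ring
  have g2 : ∀ t ∈ Set.Ioi x, green φ χ x t * f t = φ x * (χ t * f t) := by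
    intro t ht
    rw [green, if_pos (Set.mem_Ioi.1 ht)]; ring
  rw [← intervalIntegral.integral_Iic_add_Ioi (b := x)
    ((integrableOn_congr_fun g1 measurableSet_Iic).2
      ((integrable_mul_of_memLp hφ2 hf).const_mul _).integrableOn)
    ((integrableOn_congr_fun g2 measurableSet_Ioi).2
      ((integrable_mul_of_memLp hχ2 hf).const_mul _).integrableOn),
    setIntegral_congr_fun measurableSet_Iic g1, setIntegral_congr_fun measurableSet_Ioi g2,
    integral_const_mul, integral_const_mul, variation, lowerCoeff, upperCoeff]
  ring

theorem wronskian_variation (ψ ψ₁ : ℝ → ℂ) (x : ℝ) :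
    wronskian (E.variation φ χ φ χ f) (E.variation φ χ φ₁ χ₁ f) ψ ψ₁ x =
      E.upperCoeff χ f x * wronskian φ φ₁ ψ ψ₁ x +
        E.lowerCoeff φ f x * wronskian χ χ₁ ψ ψ₁ x := by
  simp only [wronskian, variation]; ring

theorem bca_variation {α : ℂ} (h : E.BCa α φ φ₁) :
    E.BCa α (E.variation φ χ φ χ f) (E.variation φ χ φ₁ χ₁ f) := by
  simp only [BCa, variation, lowerCoeff_a] at h ⊢
  linear_combination E.upperCoeff χ f E.a * h

end VariationOfConstants

/-! ### Solutions vanishing almost everywhere -/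

section Nontrivial

/-- A solution that vanishes almost everywhere has vanishing initial values. -/
theorem IsSolution.initial_eq_zero {z : ℂ} {y u : ℝ → ℂ} (hy : E.IsSolution z y u)
    (h0 : y =ᵐ[E.wMeasure E.I] 0) : y E.a = 0 ∧ u E.a = 0 := by
  obtain ⟨c, hc, hac⟩ := exists_mem_I_gt E.a_mem_I
  have hsub := Icc_subset_I hc
  have hzero : Set.EqOn y 0 (Set.Icc E.a c) := by
    refine Measure.eqOn_Icc_of_ae_eq volume hac.ne ?_ (hy.1.mono hsub) continuousOn_const
    rw [EventuallyEq, ae_wMeasure E.measurableSet_I subset_rfl] at h0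
    exact ae_restrict_of_ae_restrict_of_subset hsub h0
  have ha : y E.a = 0 := hzero (Set.left_mem_Icc.2 hac.le)
  -- With y = 0 on [a,c] the equation makes u constant there.
  have hu : ∀ x ∈ Set.Icc E.a c, u x = u E.a := by
    intro x hx
    rw [(hy.2.2 x (hsub hx)).2, intervalIntegral.integral_congr (g := fun _ => (0 : ℂ))]
    · simp
    · intro t ht
      rw [Set.uIcc_of_le hx.1] at ht
      have : y t = 0 := hzero ⟨ht.1, ht.2.trans hx.2⟩
      simp [this]
  have hint : ∀ x ∈ Set.Icc E.a c, ∫ t in E.a..x, u t / E.p t = 0 := by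
    intro x hx
    have h := (hy.2.2 x (hsub hx)).1
    have hx0 : y x = 0 := hzero hx
    rw [hx0, ha, zero_add] at h
    exact h.symm
  refine ⟨ha, ?_⟩
  -- The primitive of u/p vanishes on [a,c]; differentiating it at a point where p ≠ 0 forces the
  -- constant u(a) to be 0.
  have hae := (intervalIntegrable_div_p hc (hy.2.1.mono hsub)).ae_hasDerivAt_integral
  have hpos : volume (Set.Ioo E.a c) ≠ 0 := by simp [hac]
  obtain ⟨x, hx, hd, hp⟩ := ((frequently_ae_mem_iff.2 hpos).and_eventually
    (hae.and E.p_ne_zero)).exists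
  have hxc : x ∈ Set.Icc E.a c := Set.Ioo_subset_Icc_self hx
  have h1 := hd (by rwa [Set.uIcc_of_le hac.le]) E.a Set.left_mem_uIcc
  have h2 : HasDerivAt (fun x => ∫ t in E.a..x, u t / E.p t) 0 x := by
    refine (hasDerivAt_const x (0 : ℂ)).congr_of_eventuallyEq ?_
    filter_upwards [Ioo_mem_nhds hx.1 hx.2] with s hs using hint s (Set.Ioo_subset_Icc_self hs)
  have h3 := h1.unique h2
  rw [hu x hxc, div_eq_zero_iff] at h3
  exact h3.resolve_right (hp (hsub hxc))

end Nontrivial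

end SLExpr

end

noncomputable section

theorem indicatorCLM_add_compl {X : Type*} [MeasurableSpace X] {μ : Measure X} {s t : Set X}
    (hs : MeasurableSet s) (ht : MeasurableSet t) (hst : t = sᶜ) (f : Lp ℂ 2 μ) :
    indicatorCLM μ hs f + indicatorCLM μ ht f = f := by
  refine Lp.ext ?_
  filter_upwards [Lp.coeFn_add (indicatorCLM μ hs f) (indicatorCLM μ ht f),
    coeFn_indicatorCLM hs f, coeFn_indicatorCLM ht f] with x h1 h2 h3
  rw [h1, Pi.add_apply, h2, h3, hst]
  exact Set.indicator_self_add_compl_apply s f x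

/-! ### Boundary values at the end point and the two resolvents -/

namespace SLExpr

variable {E : SLExpr}

theorem IsSolution.tendsto_wronskian {l m : ℂ} {y u v v₁ : ℝ → ℂ} (hy : E.IsSolution l y u)
    (hv : E.IsSolution m v v₁) (hy2 : MemLp y 2 (E.wMeasure E.I))
    (hv2 : MemLp v 2 (E.wMeasure E.I)) :
    ∃ ω : ℂ, Tendsto (wronskian y u v v₁) E.atEnd (𝓝 ω) := by
  refine ⟨_, (((tendsto_setIntegral_Iic (integrable_mul_of_memLp hy2 hv2)).const_mul
    (l - m)).const_add (wronskian y u v v₁ E.a)).congr' ?_⟩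
  filter_upwards [eventually_mem_I] with x hx using (hy.wronskian_eq hv hx).symm

section Resolvent

variable {α z : ℂ} {φ φ₁ χ χ₁ ψ ψ₁ : ℝ → ℂ}

/-- If `z` is in the resolvent set, the solution satisfying the boundary condition at `a` does not
satisfy the one at `b`. -/
theorem not_tendsto_wronskian_zero {R : E.L2w E.I →L[ℂ] E.L2w E.I}
    (hR : IsResolventAt (E.graphM α ψ ψ₁) z R) (hφ : E.IsSolution z φ φ₁)
    (hφ2 : MemLp φ 2 (E.wMeasure E.I)) (hbc : E.BCa α φ φ₁) (hne : φ E.a ≠ 0 ∨ φ₁ E.a ≠ 0) :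
    ¬ Tendsto (wronskian φ φ₁ ψ ψ₁) E.atEnd (𝓝 0) := by
  intro h
  have hmem : (hφ2.toLp φ, z • hφ2.toLp φ - 0) ∈ E.graphM α ψ ψ₁ := by
    refine ⟨φ, φ₁, hφ2.coeFn_toLp, ?_, hbc, h⟩
    refine Solves.congr (fun _ => Icc_subset_I) E.measurableSet_I (fun x hx => hx.1) hφ ?_
    rw [EventuallyEq, ← ae_wMeasure E.measurableSet_I subset_rfl, sub_zero]
    filter_upwards [Lp.coeFn_smul z (hφ2.toLp φ), hφ2.coeFn_toLp] with x h1 h2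
    rw [h1, Pi.smul_apply, h2, smul_eq_mul]
  have h0 : hφ2.toLp φ = 0 := by rw [← (hR _ _).2 hmem, map_zero]
  have hae : φ =ᵐ[E.wMeasure E.I] 0 := by
    refine hφ2.coeFn_toLp.symm.trans ?_
    rw [h0]
    exact Lp.coeFn_zero _ _ _
  obtain ⟨h1, h2⟩ := hφ.initial_eq_zero hae
  exact hne.elim (fun h => h h1) (fun h => h h2)

/-- The resolvent is given by variation of constants. -/
theorem resolvent_eq_variation {R : E.L2w E.I →L[ℂ] E.L2w E.I}
    (hR : IsResolventAt (E.graphM α ψ ψ₁) z R) (hφ : E.IsSolution z φ φ₁)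
    (hχ : E.IsSolution z χ χ₁) (hW : wronskian φ φ₁ χ χ₁ E.a = 1)
    (hφ2 : MemLp φ 2 (E.wMeasure E.I)) (hχ2 : MemLp χ 2 (E.wMeasure E.I))
    (hbc : E.BCa α φ φ₁) {ω : ℂ} (hω : Tendsto (wronskian φ φ₁ ψ ψ₁) E.atEnd (𝓝 ω))
    (hχb : Tendsto (wronskian χ χ₁ ψ ψ₁) E.atEnd (𝓝 0)) (f : E.L2w E.I) :
    R f =ᵐ[E.wMeasure E.I] E.variation φ χ φ χ f := by
  have hf := Lp.memLp f
  have hY := memLp_variation hφ hχ hW hφ2 hχ2 hf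
  have hmem : (hY.toLp _, z • hY.toLp _ - f) ∈ E.graphM α ψ ψ₁ := by
    refine ⟨_, _, hY.coeFn_toLp, ?_, bca_variation (χ := χ) (χ₁ := χ₁) hbc, ?_⟩
    · refine Solves.congr (fun _ => Icc_subset_I) E.measurableSet_I (fun x hx => hx.1)
        (solves_variation hφ hχ hW hφ2 hχ2 hf) ?_
      rw [EventuallyEq, ← ae_wMeasure E.measurableSet_I subset_rfl]
      filter_upwards [Lp.coeFn_sub (z • hY.toLp _) f, Lp.coeFn_smul z (hY.toLp _),
        hY.coeFn_toLp] with x h1 h2 h3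
      rw [h1, Pi.sub_apply, h2, Pi.smul_apply, h3, smul_eq_mul]
    -- In the Wronskian with ψ, the coefficient of φ is a vanishing tail against the finite limit ω,
    -- and the coefficient of χ is bounded against [χ,ψ] → 0.
    · have h := ((tendsto_setIntegral_Ioi (integrable_mul_of_memLp hχ2 hf)).mul hω).add
        ((tendsto_setIntegral_Iic (integrable_mul_of_memLp hφ2 hf)).mul hχb)
      rw [zero_mul, mul_zero, add_zero] at h
      exact h.congr fun x => (wronskian_variation ψ ψ₁ x).symm
  rw [(hR _ _).2 hmem]
  exact hY.coeFn_toLp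

theorem upperCoeff_indicatorCLM (v : ℝ → ℂ) (c : ℝ) (f : E.L2w E.I) :
    E.upperCoeff v (indicatorCLM (E.wMeasure E.I) (measurableSet_Iic (a := c)) f) c = 0 := by
  refine setIntegral_eq_zero_of_ae_eq_zero ?_
  filter_upwards [coeFn_indicatorCLM (measurableSet_Iic (a := c)) f] with t ht hmem
  have hn : t ∉ Set.Iic c := fun h => absurd (Set.mem_Iic.1 h) (not_le.2 (Set.mem_Ioi.1 hmem))
  rw [ht, Set.indicator_of_notMem hn, mul_zero]

/-- The resolvent of the truncated operator is given by variation of constants. -/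
theorem resolvent_trunc_eq_variation {c : ℝ} (hc : c ∈ E.I)
    {S : E.L2w (Set.Icc E.a c) →L[ℂ] E.L2w (Set.Icc E.a c)}
    (hS : IsResolventAt (E.graphTrunc α ψ ψ₁ c) z S) (hφ : E.IsSolution z φ φ₁)
    (hχ : E.IsSolution z χ χ₁) (hW : wronskian φ φ₁ χ χ₁ E.a = 1)
    (hφ2 : MemLp φ 2 (E.wMeasure E.I)) (hχ2 : MemLp χ 2 (E.wMeasure E.I))
    (hbc : E.BCa α φ φ₁) (hχc : wronskian χ χ₁ ψ ψ₁ c = 0) (f : E.L2w E.I)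
    (g : E.L2w (Set.Icc E.a c)) (hg : g =ᵐ[E.wMeasure (Set.Icc E.a c)] f) :
    S g =ᵐ[E.wMeasure (Set.Icc E.a c)] E.variation φ χ φ χ
      (indicatorCLM (E.wMeasure E.I) (measurableSet_Iic (a := c)) f) := by
  set Pf := indicatorCLM (E.wMeasure E.I) (measurableSet_Iic (a := c)) f with hPf
  have hsub := Icc_subset_I hc
  have hgP : g =ᵐ[E.wMeasure (Set.Icc E.a c)] Pf := by
    have h1 := coeFn_indicatorCLM (measurableSet_Iic (a := c)) f
    have h2 := ae_restrict_of_ae (s := Set.Icc E.a c) h1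
    rw [wMeasure_restrict measurableSet_Icc hsub] at h2
    have h3 : ∀ᵐ x ∂(E.wMeasure (Set.Icc E.a c)), x ∈ Set.Icc E.a c := by
      rw [ae_wMeasure measurableSet_Icc hsub]
      exact ae_restrict_mem measurableSet_Icc
    filter_upwards [hg, h2, h3] with x hx1 hx2 hx3
    rw [hx1, hx2, Set.indicator_of_mem (Set.mem_Iic.2 hx3.2)]
  have hf := Lp.memLp Pf
  have hY := memLp_Icc (memLp_variation hφ hχ hW hφ2 hχ2 hf) hc
  have hmem : (hY.toLp _, z • hY.toLp _ - g) ∈ E.graphTrunc α ψ ψ₁ c := by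
    refine ⟨_, _, hY.coeFn_toLp, ?_, bca_variation (χ := χ) (χ₁ := χ₁) hbc, ?_⟩
    · refine Solves.congr (fun x hx => Set.Icc_subset_Icc_right hx.2) measurableSet_Icc
        (fun x hx => hx.1) ((solves_variation hφ hχ hW hφ2 hχ2 hf).mono hsub) ?_
      rw [EventuallyEq, ← ae_wMeasure measurableSet_Icc hsub]
      filter_upwards [Lp.coeFn_sub (z • hY.toLp _) g, Lp.coeFn_smul z (hY.toLp _),
        hY.coeFn_toLp, hgP] with x h1 h2 h3 h4
      rw [h1, Pi.sub_apply, h2, Pi.smul_apply, h3, smul_eq_mul, h4]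
    -- The cutoff removes everything beyond c, so at c the φ term vanishes exactly, and [χ,ψ](c) = 0
    -- kills the other.
    · rw [wronskian_variation, hχc, mul_zero, add_zero, hPf, upperCoeff_indicatorCLM, zero_mul]
  rw [(hS _ _).2 hmem]
  exact hY.coeFn_toLp

/-- The two partial integrals of φf now multiply the same function φ and join to the full integral:
the correction has rank one. -/
theorem variation_add_const_mul (hφ2 : MemLp φ 2 (E.wMeasure E.I))
    (hχ2 : MemLp χ 2 (E.wMeasure E.I)) {f : ℝ → ℂ} (hf : MemLp f 2 (E.wMeasure E.I)) (κ : ℂ)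
    (x : ℝ) :
    E.variation φ (fun s => χ s + κ * φ s) φ (fun s => χ s + κ * φ s) f x =
      E.variation φ χ φ χ f x + κ * (∫ t, φ t * f t ∂(E.wMeasure E.I)) * φ x := by
  have hφf := integrable_mul_of_memLp hφ2 hf
  have hχf := integrable_mul_of_memLp hχ2 hf
  have e : E.upperCoeff (fun s => χ s + κ * φ s) f x =
      E.upperCoeff χ f x + κ * E.upperCoeff φ f x := by
    simp only [upperCoeff]
    rw [← integral_const_mul, ← integral_add hχf.restrict (hφf.const_mul κ).restrict]
    refine integral_congr_ae (Eventually.of_forall fun t => ?_)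
    ring
  rw [← setIntegral_Iic_add_Ioi hφf x]
  simp only [variation, e]
  simp only [upperCoeff, lowerCoeff]
  ring

theorem integral_green_indicatorCLM {c : ℝ} (hc : c ∈ E.I) (f : E.L2w E.I) (x : ℝ) :
    ∫ t, green φ χ x t * indicatorCLM (E.wMeasure E.I) (measurableSet_Iic (a := c)) f t
        ∂(E.wMeasure E.I) =
      ∫ t in E.a..c, green φ χ x t * f t * (E.w t : ℂ) := by
  have h1 : ∫ t in E.a..c, green φ χ x t * f t * (E.w t : ℂ) =
      ∫ t in E.a..c, (E.w t : ℂ) * (green φ χ x t * f t) :=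
    intervalIntegral.integral_congr fun t _ => mul_comm _ _
  rw [h1, intervalIntegral_w_mul_eq_Iic hc, ← integral_indicator measurableSet_Iic]
  refine integral_congr_ae ?_
  filter_upwards [coeFn_indicatorCLM (measurableSet_Iic (a := c)) f] with t ht
  rw [ht]
  by_cases h : t ∈ Set.Iic c <;> simp [h]

/-- Cauchy-Schwarz on the tail, where only the factor v has to be small; this makes the bound
uniform in f. -/
theorem integral_norm_mul_indicatorCLM_le {v : ℝ → ℂ} (hv : MemLp v 2 (E.wMeasure E.I)) (c : ℝ)
    (f : E.L2w E.I) :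
    ∫ t, ‖v t * indicatorCLM (E.wMeasure E.I) (measurableSet_Ioi (a := c)) f t‖
        ∂(E.wMeasure E.I) ≤
      √(∫ t in Set.Ioi c, ‖v t‖ ^ 2 ∂(E.wMeasure E.I)) * ‖f‖ := by
  have e : ∫ t, ‖v t * indicatorCLM (E.wMeasure E.I) (measurableSet_Ioi (a := c)) f t‖
      ∂(E.wMeasure E.I) = ∫ t in Set.Ioi c, ‖v t * f t‖ ∂(E.wMeasure E.I) := by
    rw [← integral_indicator measurableSet_Ioi]
    refine integral_congr_ae ?_
    filter_upwards [coeFn_indicatorCLM (measurableSet_Ioi (a := c)) f] with t ht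
    rw [ht]
    by_cases h : t ∈ Set.Ioi c <;> simp [h]
  have hf := Lp.memLp f
  rw [e]
  refine (integral_norm_mul_le_sqrt (hv.restrict _) (hf.restrict _)).trans ?_
  rw [norm_eq_sqrt_integral f]
  gcongr
  · exact Eventually.of_forall fun t => sq_nonneg _
  · exact (memLp_two_iff_integrable_sq_norm hf.1).1 hf
  · exact Measure.restrict_le_self

/-- Integral operators with the Green's function as kernel are small on functions supported near the
end point `b`. -/
theorem tendsto_norm_comp_indicatorCLM {R : E.L2w E.I →L[ℂ] E.L2w E.I}
    (hφ2 : MemLp φ 2 (E.wMeasure E.I)) (hχ2 : MemLp χ 2 (E.wMeasure E.I))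
    (hR : ∀ f, R f =ᵐ[E.wMeasure E.I] E.variation φ χ φ χ f) :
    Tendsto (fun c => ‖R ∘L indicatorCLM (E.wMeasure E.I) (measurableSet_Ioi (a := c))‖)
      E.atEnd (𝓝 0) := by
  have hN : ∀ v : ℝ → ℂ, MemLp v 2 (E.wMeasure E.I) →
      Tendsto (fun c => √(∫ t in Set.Ioi c, ‖v t‖ ^ 2 ∂(E.wMeasure E.I))) E.atEnd (𝓝 0) := by
    intro v hv
    have h := (tendsto_setIntegral_Ioi ((memLp_two_iff_integrable_sq_norm hv.1).1 hv)).sqrt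
    rwa [Real.sqrt_zero] at h
  have hA := hφ2.norm.add hχ2.norm
  have hlim := ((hN χ hχ2).add (hN φ hφ2)).mul_const ‖hA.toLp _‖
  rw [add_zero, zero_mul] at hlim
  refine squeeze_zero (fun _ => norm_nonneg _) (fun c => ?_) hlim
  refine ContinuousLinearMap.opNorm_le_bound _ (by positivity) fun f => ?_
  set Pf := indicatorCLM (E.wMeasure E.I) (measurableSet_Ioi (a := c)) f with hPf
  have h1 := integral_norm_mul_indicatorCLM_le hχ2 c f
  have h2 := integral_norm_mul_indicatorCLM_le hφ2 c f
  have key : ‖R Pf‖ ≤ ((√(∫ t in Set.Ioi c, ‖χ t‖ ^ 2 ∂(E.wMeasure E.I)) +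
      √(∫ t in Set.Ioi c, ‖φ t‖ ^ 2 ∂(E.wMeasure E.I))) * ‖f‖) * ‖hA.toLp _‖ := by
    refine Lp.norm_le_mul_norm_of_ae_le_mul ?_
    filter_upwards [hR Pf, hA.coeFn_toLp] with x hx1 hx2
    rw [hx1, hx2]
    refine (norm_variation_le hφ2 hχ2 (Lp.memLp Pf) x).trans ?_
    refine mul_le_mul_of_nonneg_right ?_ (norm_nonneg _)
    linarith
  refine key.trans (le_of_eq ?_)
  ring

end Resolvent

end SLExpr

end

/-! ### Norm resolvent convergence -/

theorem mainTheorem4 (E : SLExpr) (α : ℂ) (η : ℝ) (K : ℂ) (hS : (η, K) ∈ E.S α)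
    (hcase : E.CaseII η K ∨ E.CaseIII η K)
    (θ θ₁ φ φ₁ : ℂ → ℝ → ℂ) (hfund : E.IsFundamentalPair α θ θ₁ φ φ₁)
    -- the boundary condition at `b`: `ψ = θ(·, l') + m' φ(·, l')`
    (l' : ℂ) (hl' : l' ∈ SLExpr.halfPlane η K) (m' : ℂ) (ψ ψ₁ : ℝ → ℂ)
    (hψ : ψ = fun x => θ l' x + m' * φ l' x) (hψ₁ : ψ₁ = fun x => θ₁ l' x + m' * φ₁ l' x)
    (bn : ℕ → ℝ) (hmono : Monotone bn) (hbn : ∀ n, E.a < bn n ∧ (bn n : EReal) < E.b)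
    (hlim : Tendsto (fun n => (bn n : EReal)) atTop (𝓝 E.b))
    (z : ℂ) (hz : z ∉ graphSpectrum (E.graphM α ψ ψ₁))
    (hzn : ∀ᶠ n in atTop, z ∉ graphSpectrum (E.graphTrunc α ψ ψ₁ (bn n)))
    (mn : ℕ → ℂ)
    (hmn : ∀ n, mn n = SLExpr.mTrunc (θ z) (θ₁ z) (φ z) (φ₁ z) ψ ψ₁ (bn n)) :
    ∃ (R : E.L2w E.I →L[ℂ] E.L2w E.I) (Rn : ℕ → E.L2w E.I →L[ℂ] E.L2w E.I),
      IsResolventAt (E.graphM α ψ ψ₁) z R ∧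
      -- `Rn n` is the integral operator with the Green's function as its kernel
      (∀ᶠ n in atTop, ∀ f : E.L2w E.I, Rn n f =ᵐ[E.wMeasure E.I] fun x =>
        ∫ t in E.a..bn n,
          SLExpr.green (φ z) (fun s => θ z s + mn n * φ z s) x t * f t * (E.w t : ℂ)) ∧
      -- `Rn n` extends the resolvent of the truncated operator
      (∀ᶠ n in atTop,
        ∀ Sn : E.L2w (Set.Icc E.a (bn n)) →L[ℂ] E.L2w (Set.Icc E.a (bn n)),
          IsResolventAt (E.graphTrunc α ψ ψ₁ (bn n)) z Sn →
          ∀ (f : E.L2w E.I) (g : E.L2w (Set.Icc E.a (bn n))),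
            g =ᵐ[E.wMeasure (Set.Icc E.a (bn n))] f →
            Rn n f =ᵐ[E.wMeasure (Set.Icc E.a (bn n))] Sn g) ∧
      Tendsto (fun n => ‖Rn n - R‖) atTop (𝓝 0) := by
  obtain ⟨R, hR⟩ := not_not.1 hz
  obtain ⟨l, hl⟩ : ∃ l, ∀ y u : ℝ → ℂ, E.IsSolution l y u → E.SqIntegrable y := by
    rcases hcase with ⟨l, -, -, h⟩ | ⟨l, -, h⟩
    · exact ⟨l, h⟩
    · exact ⟨l, fun y u hy => (h y u hy).1⟩
  have hW : ∀ k, SLExpr.wronskian (φ k) (φ₁ k) (θ k) (θ₁ k) E.a = 1 := by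
    intro k
    obtain ⟨-, -, h1, h2, h3, h4⟩ := hfund k
    rw [SLExpr.wronskian, h1, h2, h3, h4]
    linear_combination Complex.sin_sq_add_cos_sq α
  have hL2 : ∀ {k : ℂ} {y u : ℝ → ℂ}, E.IsSolution k y u → MemLp y 2 (E.wMeasure E.I) :=
    fun hy => SLExpr.IsSolution.memLp (hfund l).1 (hfund l).2.1 (hW l)
      (SLExpr.memLp_of_sqIntegrable (hfund l).1.1 (hl _ _ (hfund l).1))
      (SLExpr.memLp_of_sqIntegrable (hfund l).2.1.1 (hl _ _ (hfund l).2.1)) hy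
  obtain ⟨hθz, hφz, hφa, hφ₁a, -, -⟩ := hfund z
  have hψs : E.IsSolution l' ψ ψ₁ := by
    rw [hψ, hψ₁]; exact (hfund l').1.add_const_mul (hfund l').2.1 m'
  have hφ2 := hL2 hφz
  have hbc : E.BCa α (φ z) (φ₁ z) := by
    rw [SLExpr.BCa, hφa, hφ₁a]; ring
  have hne : φ z E.a ≠ 0 ∨ φ₁ z E.a ≠ 0 := by
    by_contra! h
    have := hW z
    rw [SLExpr.wronskian, h.1, h.2] at this
    simp at this
  obtain ⟨ω, hω⟩ := hφz.tendsto_wronskian hψs hφ2 (hL2 hψs)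
  obtain ⟨τ, hτ⟩ := hθz.tendsto_wronskian hψs (hL2 hθz) (hL2 hψs)
  have hω0 : ω ≠ 0 := fun h =>
    SLExpr.not_tendsto_wronskian_zero hR hφz hφ2 hbc hne (h ▸ hω)
  have hbI : ∀ n, bn n ∈ E.I := fun n => ⟨(hbn n).1.le, (hbn n).2⟩
  have hbend : Tendsto bn atTop E.atEnd :=
    tendsto_comap_iff.2 (tendsto_nhdsWithin_iff.2 ⟨hlim, Eventually.of_forall fun n => (hbn n).2⟩)
  have hWadd : ∀ (κ : ℂ) (x : ℝ), SLExpr.wronskian (fun s => θ z s + κ * φ z s)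
      (fun s => θ₁ z s + κ * φ₁ z s) ψ ψ₁ x = SLExpr.wronskian (θ z) (θ₁ z) ψ ψ₁ x +
        κ * SLExpr.wronskian (φ z) (φ₁ z) ψ ψ₁ x := by
    intro κ x
    simp only [SLExpr.wronskian]; ring
  have hWone : ∀ κ : ℂ, SLExpr.wronskian (φ z) (φ₁ z) (fun s => θ z s + κ * φ z s)
      (fun s => θ₁ z s + κ * φ₁ z s) E.a = 1 := by
    intro κ
    rw [← hW z]
    simp only [SLExpr.wronskian]; ring
  set m : ℂ := -τ / ω with hm
  have hmlim : Tendsto mn atTop (𝓝 m) := by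
    refine (((hτ.comp hbend).neg).div (hω.comp hbend) hω0).congr fun n => ?_
    rw [hmn n]; rfl
  -- Where this Wronskian is 0, division in `mTrunc` returns the default value 0. Since ω ≠ 0 this
  -- affects only finitely many n, and only the boundary condition at b_n depends on it.
  have hWn : ∀ᶠ n in atTop, SLExpr.wronskian (φ z) (φ₁ z) ψ ψ₁ (bn n) ≠ 0 :=
    (hω.comp hbend).eventually_ne hω0
  set χ : ℝ → ℂ := fun s => θ z s + m * φ z s with hχ
  set χ₁ : ℝ → ℂ := fun s => θ₁ z s + m * φ₁ z s with hχ₁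
  have hχs : E.IsSolution z χ χ₁ := hθz.add_const_mul hφz m
  have hχ2 := hL2 hχs
  have hχb : Tendsto (SLExpr.wronskian χ χ₁ ψ ψ₁) E.atEnd (𝓝 0) := by
    have h := hτ.add (hω.const_mul m)
    have e : τ + m * ω = 0 := by rw [hm]; field_simp; ring
    rw [e] at h
    exact h.congr fun x => (hWadd m x).symm
  have hRv : ∀ f : E.L2w E.I, R f =ᵐ[E.wMeasure E.I] E.variation (φ z) χ (φ z) χ f :=
    SLExpr.resolvent_eq_variation hR hφz hχs (hWone m) hφ2 hχ2 hbc hω hχb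
  set P : ℕ → E.L2w E.I →L[ℂ] E.L2w E.I := fun n =>
    indicatorCLM (E.wMeasure E.I) (measurableSet_Iic (a := bn n)) with hP
  set T : E.L2w E.I →L[ℂ] E.L2w E.I := (pairingCLM hφ2).smulRight (hφ2.toLp (φ z)) with hT
  -- Defining R_n through R, T and the cutoff makes boundedness automatic; this step identifies it
  -- with variation of constants for θ + m_n φ.
  have hRn : ∀ (n : ℕ) (f : E.L2w E.I), ((R + (mn n - m) • T) ∘L P n) f =ᵐ[E.wMeasure E.I]
      E.variation (φ z) (fun s => θ z s + mn n * φ z s) (φ z)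
        (fun s => θ z s + mn n * φ z s) (P n f) := by
    intro n f
    have e : (fun s => θ z s + mn n * φ z s) = fun s => χ s + (mn n - m) * φ z s := by
      funext s; simp only [hχ]; ring
    have e' : ((R + (mn n - m) • T) ∘L P n) f =
        R (P n f) + ((mn n - m) * pairingCLM hφ2 (P n f)) • hφ2.toLp (φ z) := by
      simp [hT, smul_smul]
    rw [e, e']
    filter_upwards [Lp.coeFn_add (R (P n f))
      (((mn n - m) * pairingCLM hφ2 (P n f)) • hφ2.toLp (φ z)), hRv (P n f),
      Lp.coeFn_smul ((mn n - m) * pairingCLM hφ2 (P n f)) (hφ2.toLp (φ z)),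
      hφ2.coeFn_toLp] with x h1 h2 h3 h4
    rw [h1, Pi.add_apply, h2, h3, Pi.smul_apply, h4,
      SLExpr.variation_add_const_mul hφ2 hχ2 (Lp.memLp _), pairingCLM_apply, smul_eq_mul]
  refine ⟨R, fun n => (R + (mn n - m) • T) ∘L P n, hR, ?_, ?_, ?_⟩
  · refine Eventually.of_forall fun n f => (hRn n f).trans (Eventually.of_forall fun x => ?_)
    beta_reduce
    rw [SLExpr.variation_eq_integral_green hφ2 (hL2 (hθz.add_const_mul hφz (mn n))) (Lp.memLp _),
      hP, SLExpr.integral_green_indicatorCLM (hbI n)]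
  · filter_upwards [hWn] with n hn Sn hSn f g hg
    have hzero : SLExpr.wronskian (fun s => θ z s + mn n * φ z s)
        (fun s => θ₁ z s + mn n * φ₁ z s) ψ ψ₁ (bn n) = 0 := by
      rw [hWadd, hmn n, SLExpr.mTrunc, div_mul_cancel₀ _ hn, add_neg_cancel]
    have h := SLExpr.resolvent_trunc_eq_variation (hbI n) hSn hφz
      (hθz.add_const_mul hφz (mn n)) (hWone (mn n)) hφ2 (hL2 (hθz.add_const_mul hφz (mn n)))
      hbc hzero f g hg
    have h' := ae_restrict_of_ae (s := Set.Icc E.a (bn n)) (hRn n f)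
    rw [SLExpr.wMeasure_restrict measurableSet_Icc (SLExpr.Icc_subset_I (hbI n))] at h'
    exact EventuallyEq.trans h' h.symm
  · have h1 : Tendsto (fun n => ‖mn n - m‖ * ‖T‖) atTop (𝓝 0) := by
      have h := (tendsto_iff_norm_sub_tendsto_zero.1 hmlim).mul_const ‖T‖
      rwa [zero_mul] at h
    have h2 := (SLExpr.tendsto_norm_comp_indicatorCLM hφ2 hχ2 hRv).comp hbend
    have h3 := h1.add h2
    rw [add_zero] at h3
    refine squeeze_zero (fun _ => norm_nonneg _) (fun n => ?_) h3
    have e : (R + (mn n - m) • T) ∘L P n - R = ((mn n - m) • T) ∘L P n -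
        R ∘L indicatorCLM (E.wMeasure E.I) (measurableSet_Ioi (a := bn n)) := by
      ext1 f
      have hf := indicatorCLM_add_compl (measurableSet_Iic (a := bn n))
        (measurableSet_Ioi (a := bn n)) Set.compl_Iic.symm f
      have hRf : R f = R (P n f) +
          R (indicatorCLM (E.wMeasure E.I) (measurableSet_Ioi (a := bn n)) f) := by
        rw [← map_add, hf]
      simp only [sub_apply, ContinuousLinearMap.comp_apply,
        add_apply, hRf]
      abel
    rw [e]
    refine (norm_sub_le _ _).trans (add_le_add_left ?_ _)
    refine (ContinuousLinearMap.opNorm_comp_le _ _).trans ?_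
    rw [norm_smul]
    -- The cutoff has norm at most 1, so the rank one term costs at most |m_n - m| ‖T‖.
    exact mul_le_of_le_one_right (by positivity) (norm_indicatorCLM_le _)
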